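/- Let $c>0$ and let $\lambda\in C^1\bigl((0,\infty),[0,\infty)\bigr)$. Let $\{(X(t),Y(t))\}_{t\ge0}$ be a reflecting orthogonal planar motion with speed $c$ and rate function $\lambda$: the particle starts at the origin and moves with speed $c$ along one of the four directions $d_k=(\cos(k\pi/2),\sin(k\pi/2))$, $k=0,1,2,3$; the initial direction is uniformly distributed, and at each event of a non-homogeneous Poisson process with rate function $\lambda$ the particle switches to one of the other three directions, chosen uniformly and independently of the Poisson process. Put $\Lambda(t)=\int_0^t\lambda(s)\,ds\in[0,\infty]$. (If $\Lambda(t)=\infty$ for $t>0$, the events accumulate at time $0$; then the description is required from every time $s>0$ on: the direction at time $s$ is uniformly distributed and is switched as above at the Poisson events after $s$.) Let $Z$ be either of the marginal processes $X$, $Y$, and for $t>0$ let $p(\cdot,t)$ be the density of the absolutely continuous component of the distribution of $Z(t)$. Then $p$ satisfies the third-order partial differential equation $$\frac{\partial^3p}{\partial t^3}+\frac{8\lambda(t)}{3}\frac{\partial^2p}{\partial t^2}+\frac43\Bigl(\frac43\lambda(t)^2+\lambda'(t)\Bigr)\frac{\partial p}{\partial t}=c^2\frac{\partial^3p}{\partial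 t\,\partial x^2}+\frac{2c^2\lambda(t)}{3}\frac{\partial^2p}{\partial x^2}$$ for $t>0$ and, if $\Lambda(t)<\infty$, away from the atoms $x\in\{0,ct,-ct\}$, in the following sense. 1. (In the sense of distributions in $x$ and classically in $t$.) Let $t>0$ and $\psi\in C_c^\infty(\mathbb R)$, where, if $\Lambda(t)<\infty$, the support of $\psi$ contains none of $0,ct,-ct$. Then $F(s)=\int\psi(x)p(x,s)\,dx$ is of class $C^3$ and $G(s)=\int\psi''(x)p(x,s)\,dx$ is of class $C^1$ in a neighbourhood of $t$, and $$F'''(t)+\frac{8\lambda(t)}{3}F''(t)+\frac43\Bigl(\frac43\lambda(t)^2+\lambda'(t)\Bigr)F'(t)=c^2G'(t)+\frac{2c^2\lambda(t)}{3}G(t).$$ 2. (Pointwise.) In every open set $U\subset\mathbb R\times(0,\infty)$ which contains no point $(x,t)$ with $\Lambda(t)<\infty$ and $x\in\{0,ct,-ct\}$, and on which $p$ has a version of class $C^3$ (a function in $C^3(U)$ that for every $t>0$ equals $p(\cdot,t)$ almost everywhere on $\{x:(x,t)\in U\}$), this version satisfies the equation at every point of $U$. Finally, if $t>0$ and $\Lambda(t)<\infty$,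 then $$P\{Z(t)=ct\}=P\{Z(t)=-ct\}=\frac{e^{-\Lambda(t)}}{4},\qquad P\{Z(t)=0\}=\frac{e^{-\frac23\Lambda(t)}}{2}.$$ -/

import Mathlib

open MeasureTheory ProbabilityTheory Set
open scoped ENNReal NNReal

noncomputable section

namespace ReflectingMotion

variable {Ω : Type*} [MeasurableSpace Ω]

/-- The number of points of the random set `T` (the event times) in the interval `(a, b]`. -/
def count (T : Ω → Set ℝ) (a b : ℝ) (ω : Ω) : ℕ := (T ω ∩ Ioc a b).ncard

/-- `T` is the random set of event times of a non-homogeneous Poisson process on `(0, ∞)` with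
rate function `lam`. Nothing is required on intervals `(0, b]` on which `lam` is not integrable:
there the event times accumulate at `0`. -/
structure IsPoissonProcess (P : Measure Ω) (lam : ℝ → ℝ) (T : Ω → Set ℝ) : Prop where
  pos : ∀ ω, T ω ⊆ Ioi 0
  finite : ∀ a b, 0 ≤ a → IntegrableOn lam (Ioc a b) volume → ∀ ω, (T ω ∩ Ioc a b).Finite
  measurable : ∀ a b, 0 ≤ a → IntegrableOn lam (Ioc a b) volume → Measurable (count T a b)
  law : ∀ a b, 0 ≤ a → a ≤ b → IntegrableOn lam (Ioc a b) volume →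
    P.map (count T a b) = poissonMeasure (∫ s in a..b, lam s).toNNReal
  indep : ∀ (n : ℕ) (u : Fin (n + 1) → ℝ), Monotone u → 0 ≤ u 0 →
    IntegrableOn lam (Ioc (u 0) (u (Fin.last n))) volume →
    iIndepFun (fun i : Fin n => count T (u i.castSucc) (u i.succ)) P

/-- The Markov chain on the four directions `0, 1, 2, 3` with uniform initial law, which at each
step switches to one of the three directions other than the current one, with probability `1/3`
each. -/
structure IsSwitchingChain (P : Measure Ω) (E : ℕ → Ω → Fin 4) : Prop where
  measurable : ∀ k, Measurable (E k)
  law : ∀ (n : ℕ) (d : ℕ → Fin 4), (∀ k < n, d (k + 1) ≠ d k) →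
    P {ω | ∀ k ≤ n, E k ω = d k} = (4 : ℝ≥0∞)⁻¹ * (3 : ℝ≥0∞)⁻¹ ^ n
  switches : ∀ (k : ℕ), ∀ᵐ ω ∂P, E (k + 1) ω ≠ E k ω

/-- From time `s` on, the direction `D` starts from a uniformly distributed direction and is
switched exactly at the event times in `T`, each time uniformly to one of the other three
directions, independently of the event times. -/
def SwitchesUniformlyFrom (P : Measure Ω) (T : Ω → Set ℝ) (D : ℝ → Ω → Fin 4) (s : ℝ) : Prop :=
  ∃ E : ℕ → Ω → Fin 4, IsSwitchingChain P E ∧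
    IndepFun (fun ω (k : ℕ) => E k ω) (fun ω (t : Ici s) => count T s t ω) P ∧
    ∀ t, s ≤ t → ∀ ω, D t ω = E (count T s t ω) ω

/-- The direction process `D` of a reflecting orthogonal planar motion whose changes of direction
occur at the event times `T` of a Poisson process with rate function `lam`.
If `∫₀ᵗ lam < ∞`, the motion starts at time `0` in a uniformly distributed direction. Otherwise
there are infinitely many events right after time `0`, hence no first one, and the description
holds from every time `s > 0` on. -/
structure IsReflectingDirection (P : Measure Ω) (lam : ℝ → ℝ) (T : Ω → Set ℝ)
    (D : ℝ → Ω → Fin 4) : Prop where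
  poisson : IsPoissonProcess P lam T
  start_zero : (∀ t, 0 < t → IntegrableOn lam (Ioc 0 t) volume) → SwitchesUniformlyFrom P T D 0
  start_pos : ¬ (∀ t, 0 < t → IntegrableOn lam (Ioc 0 t) volume) →
    ∀ s, 0 < s → SwitchesUniformlyFrom P T D s

/-- First coordinate `cos (k π / 2)` of the direction `k`. -/
def dirX : Fin 4 → ℝ := ![1, 0, -1, 0]

/-- Second coordinate `sin (k π / 2)` of the direction `k`. -/
def dirY : Fin 4 → ℝ := ![0, 1, 0, -1]

/-- The abscissa at time `t` of the particle that starts at the origin and moves with speed `c`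
in the direction `D`. -/
def posX (c : ℝ) (D : ℝ → Ω → Fin 4) (t : ℝ) (ω : Ω) : ℝ := ∫ s in 0..t, c * dirX (D s ω)

/-- The ordinate at time `t` of the particle that starts at the origin and moves with speed `c`
in the direction `D`. -/
def posY (c : ℝ) (D : ℝ → Ω → Fin 4) (t : ℝ) (ω : Ω) : ℝ := ∫ s in 0..t, c * dirY (D s ω)

/-- The density with respect to Lebesgue measure of the absolutely continuous component (in the
Lebesgue decomposition) of the distribution of `Z t`. -/
def acDensity (P : Measure Ω) (Z : ℝ → Ω → ℝ) (x t : ℝ) : ℝ :=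
  ((P.map (Z t)).rnDeriv volume x).toReal

/-- The partial differential equation
`p_ttt + (8 lam / 3) p_tt + (4/3) (4 lam² / 3 + lam') p_t = c² p_txx + (2 c² lam / 3) p_xx`
at time `t`, for functions of time: `F` stands for `p` and `G` for `p_xx`. -/
def EquationAt (c : ℝ) (lam : ℝ → ℝ) (F G : ℝ → ℝ) (t : ℝ) : Prop :=
  iteratedDeriv 3 F t + (8 * lam t / 3) * iteratedDeriv 2 F t
      + (4 / 3) * ((4 / 3) * lam t ^ 2 + deriv lam t) * deriv F t
    = c ^ 2 * deriv G t + (2 * c ^ 2 * lam t / 3) * G t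

/-- The equation holds for `p`, at all points of the open half-plane `t > 0` outside the set `A`,
in the sense of distributions with respect to `x` and in the classical sense with respect to
`t`. -/
def SolvesWeaklyOff (c : ℝ) (lam : ℝ → ℝ) (A : Set (ℝ × ℝ)) (p : ℝ → ℝ → ℝ) : Prop :=
  ∀ t, 0 < t → ∀ ψ : ℝ → ℝ, ContDiff ℝ ((⊤ : ℕ∞) : WithTop ℕ∞) ψ → HasCompactSupport ψ →
    (∀ x ∈ tsupport ψ, (x, t) ∉ A) →
    ContDiffAt ℝ 3 (fun s => ∫ x, ψ x * p x s) t ∧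
    ContDiffAt ℝ 1 (fun s => ∫ x, iteratedDeriv 2 ψ x * p x s) t ∧
    EquationAt c lam (fun s => ∫ x, ψ x * p x s) (fun s => ∫ x, iteratedDeriv 2 ψ x * p x s) t

/-- The equation holds pointwise in every open subset `U` of the half-plane `t > 0`, disjoint from
`A`, in which `p` has a version `q` of class `C³`. -/
def SolvesPointwiseOff (c : ℝ) (lam : ℝ → ℝ) (A : Set (ℝ × ℝ)) (p : ℝ → ℝ → ℝ) : Prop :=
  ∀ (U : Set (ℝ × ℝ)) (q : ℝ → ℝ → ℝ), IsOpen U → (∀ z ∈ U, 0 < z.2 ∧ z ∉ A) →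
    ContDiffOn ℝ 3 (fun z : ℝ × ℝ => q z.1 z.2) U →
    (∀ t, 0 < t → ∀ᵐ x ∂(volume : Measure ℝ), (x, t) ∈ U → q x t = p x t) →
    ∀ x t, (x, t) ∈ U →
      EquationAt c lam (fun s => q x s) (fun s => iteratedDeriv 2 (fun y => q y s) x) t

/-- The points `(x, t)` with `x ∈ {0, c t, -c t}`, for the times `t` with `∫₀ᵗ lam < ∞`: the places
where the distribution of the marginal at time `t` has its atoms. The set is empty if `∫₀ᵗ lam = ∞`
for all `t > 0`. -/
def atomLines (c : ℝ) (lam : ℝ → ℝ) : Set (ℝ × ℝ) :=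
  {z | IntegrableOn lam (Ioc 0 z.2) volume ∧ (z.1 = 0 ∨ z.1 = c * z.2 ∨ z.1 = -(c * z.2))}

end ReflectingMotion

end

namespace ReflectingMotion

open Filter Topology

/-! The engine is one computation. A switch to a uniformly chosen other direction replaces the
conditional mean of a centred observable `f - mean f` by `-1/3` times its current value, because the
four centred values sum to zero. If the number `N` of events in `(s, r]` is Poisson with mean `Λ`,
then `E (-1/3)^N = exp (-4Λ/3)`. So centred observables of the direction, tested against the past,
decay by this factor: `markov_grid` for a past sampled at finitely many times,
`IsReflectingDirection.markov` for the position, which is a limit of Riemann sums of directions.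

Together with straight motion between events this gives the Kolmogorov equation
`IsMarkovMotion.hasDerivAt_observe`: `E ψ(Z) f(D)` has derivative `c E ψ'(Z) v(D) f(D) + (4/3) λ
(mean f · E ψ(Z) - E ψ(Z) f(D))`. A coordinate velocity satisfies `mean v = 0`, `mean v² = 1/2` and
`v³ = v`, so the moments `E ψ(Z)`, `E ψ'(Z) v`, `E ψ''(Z) v²`, `E ψ''(Z)` form a closed first-order
system driven by `E ψ'''(Z) v`. Eliminating the two velocity moments (`equationAt_of_system`) gives
the third-order equation for the whole law of `Z`.

To pass to the density, the singular part of the law must be located. In a frame moving with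
velocity `c i`, on the event that the current velocity is `c i`, transport disappears: mass leaves
at rate `leaveRate v i * λ`, and mass that enters comes from paths moving relative to the frame.
Such paths spread their mass, so between two positive times their contribution is at most a multiple
of Lebesgue measure (`IsMarkovMotion.exists_observe_velocity_le`). On Lebesgue null sets the law is
therefore carried along lines of constant velocity with an exponential loss
(`IsMarkovMotion.real_velocity_mem_null`). Letting the initial time tend to `0` leaves the three
atoms if `Λ(t) < ∞`, and nothing if `Λ(t) = ∞`. Hence test functions supported off the atoms see the
density only, and the weak equation follows.

The pointwise form follows from the weak one by differentiation under the integral, two integrations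
by parts and the fundamental lemma of the calculus of variations
(`SolvesWeaklyOff.solvesPointwiseOff`). -/

/-- The average of a function over the four directions. -/
noncomputable def mean (f : Fin 4 → ℝ) : ℝ := (∑ k, f k) / 4

/-! ### The switching chain: each step contracts centred observables by `-1/3`. -/

section Chain

variable {Ω : Type*} [MeasurableSpace Ω] {P : Measure Ω}

/-- The prescribed law covers only paths without repetitions; a path with a repetition is null by
`switches`, which makes the one-step formula valid for every `d`. -/
lemma IsSwitchingChain.real_path_succ {E : ℕ → Ω → Fin 4} (hE : IsSwitchingChain P E) (n : ℕ)
    (d : ℕ → Fin 4) (k : Fin 4) :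
    P.real {ω | (∀ i ≤ n, E i ω = d i) ∧ E (n + 1) ω = k} =
      if k = d n then 0 else P.real {ω | ∀ i ≤ n, E i ω = d i} / 3 := by
  split_ifs with hk
  · rw [measureReal_def, ENNReal.toReal_eq_zero_iff]
    left
    rw [measure_eq_zero_iff_ae_notMem]
    filter_upwards [hE.switches n] with ω hω h
    exact hω (h.2.trans (hk.trans (h.1 n le_rfl).symm))
  · by_cases hd : ∀ i < n, d (i + 1) ≠ d i
    · have h1 := hE.law n d hd
      have h2 := hE.law (n + 1) (fun i => if i ≤ n then d i else k) (by
        intro i hi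
        rcases Nat.lt_succ_iff_lt_or_eq.1 hi with h | rfl
        · simpa [h.le, Nat.succ_le_iff.2 h] using hd i h
        · simpa using hk)
      have h3 : {ω | ∀ i ≤ n + 1, E i ω = if i ≤ n then d i else k} =
          {ω | (∀ i ≤ n, E i ω = d i) ∧ E (n + 1) ω = k} := by
        ext ω
        simp only [mem_ofPred_eq]
        constructor
        · intro h
          exact ⟨fun i hi => by simpa [hi] using h i (by omega), by simpa using h (n + 1) le_rfl⟩
        · rintro ⟨h, h'⟩ i hi
          rcases Nat.le_succ_iff.1 hi with hi | rfl
          · simpa [hi] using h i hi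
          · simpa using h'
      rw [h3] at h2
      rw [measureReal_def, measureReal_def, h1, h2]
      simp [pow_succ]
      ring
    · push Not at hd
      obtain ⟨i, hi, hdi⟩ := hd
      have h0 : P {ω | ∀ i ≤ n, E i ω = d i} = 0 := by
        rw [measure_eq_zero_iff_ae_notMem]
        filter_upwards [hE.switches i] with ω hω h
        exact hω (by rw [h (i + 1) (by omega), h i (by omega), hdi])
      have h1 : P {ω | (∀ i ≤ n, E i ω = d i) ∧ E (n + 1) ω = k} = 0 :=
        measure_mono_null (fun ω h => h.1) h0
      simp [measureReal_def, h0, h1]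

variable [IsProbabilityMeasure P]

lemma IsSwitchingChain.integral_succ {E : ℕ → Ω → Fin 4} (hE : IsSwitchingChain P E) (n : ℕ)
    (F : (ℕ → Fin 4) → ℝ) (hF : ∀ e e', (∀ i ≤ n, e i = e' i) → F e = F e') (f : Fin 4 → ℝ) :
    ∫ ω, F (fun i => E i ω) * (f (E (n + 1) ω) - mean f) ∂P =
      -(1 / 3) * ∫ ω, F (fun i => E i ω) * (f (E n ω) - mean f) ∂P := by
  have hmE := hE.measurable
  -- A finite path is prolonged by repeating its last value; as `F` depends on the indices up to `n`
  -- only, the choice of prolongation is immaterial.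
  set ext : (Fin (n + 1) → Fin 4) → ℕ → Fin 4 := fun d i => d ⟨min i n, by omega⟩ with hext
  set X : Ω → (Fin (n + 1) → Fin 4) := fun ω i => E i ω with hX
  have hmX : Measurable X := by fun_prop
  have hFX : ∀ ω, F (fun i => E i ω) = F (ext (X ω)) := by
    intro ω
    apply hF
    intro i hi
    simp [hext, hX, hi]
  have hset : ∀ d, X ⁻¹' {d} = {ω | ∀ i ≤ n, E i ω = ext d i} := by
    intro d
    ext1 ω
    simp only [mem_preimage, mem_singleton_iff, mem_ofPred_eq, hX, hext, funext_iff]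
    constructor
    · intro h i hi
      simpa [hi] using h ⟨i, by omega⟩
    · rintro h ⟨i, hi⟩
      simpa [Nat.lt_succ_iff.1 hi] using h i (Nat.lt_succ_iff.1 hi)
  have key : ∀ g : (Fin (n + 1) → Fin 4) × Fin 4 → ℝ,
      ∫ ω, g (X ω, E (n + 1) ω) ∂P =
        ∑ d, ∑ k, (if k = ext d n then 0 else P.real (X ⁻¹' {d}) / 3) * g (d, k) := by
    intro g
    have hm : Measurable (fun ω => (X ω, E (n + 1) ω)) := hmX.prodMk (hmE _)
    rw [← integral_map (φ := fun ω => (X ω, E (n + 1) ω)) (f := g) hm.aemeasurable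
      (by exact Measurable.of_discrete.aestronglyMeasurable)]
    have : IsProbabilityMeasure (P.map fun ω => (X ω, E (n + 1) ω)) :=
      Measure.isProbabilityMeasure_map hm.aemeasurable
    rw [integral_fintype (Integrable.of_finite), Fintype.sum_prod_type]
    refine Finset.sum_congr rfl fun d _ => Finset.sum_congr rfl fun k _ => ?_
    rw [smul_eq_mul, hset, ← hE.real_path_succ n (ext d) k,
      map_measureReal_apply hm (measurableSet_singleton _)]
    congr 2
    ext1 ω
    have := Set.ext_iff.1 (hset d) ω
    simp only [mem_preimage, mem_singleton_iff, mem_ofPred_eq, Prod.mk.injEq] at this ⊢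
    rw [this]
  have key2 : ∀ g : (Fin (n + 1) → Fin 4) → ℝ,
      ∫ ω, g (X ω) ∂P = ∑ d, P.real (X ⁻¹' {d}) * g d := by
    intro g
    rw [← integral_map (φ := X) (f := g) hmX.aemeasurable
      (by exact Measurable.of_discrete.aestronglyMeasurable)]
    have : IsProbabilityMeasure (P.map X) := Measure.isProbabilityMeasure_map hmX.aemeasurable
    rw [integral_fintype (Integrable.of_finite)]
    refine Finset.sum_congr rfl fun d _ => ?_
    rw [smul_eq_mul, map_measureReal_apply hmX (measurableSet_singleton _)]
  have e1 := key (fun z => F (ext z.1) * (f z.2 - mean f))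
  have e2 := key2 (fun d => F (ext d) * (f (ext d n) - mean f))
  have e3 : ∀ ω, ext (X ω) n = E n ω := by intro ω; simp [hext, hX]
  simp only [hFX]
  simp only [e3] at e2
  rw [e1, e2, Finset.mul_sum]
  refine Finset.sum_congr rfl fun d _ => ?_
  -- For each past path, the centred values at the three directions other than `j` sum to minus the
  -- centred value at `j`; the weight `1/3` gives the factor.
  dsimp only
  generalize ext d n = j
  generalize F (ext d) = a
  simp only [mean, Fin.sum_univ_four]
  fin_cases j <;> simp <;> ring

lemma IsSwitchingChain.integral_add {E : ℕ → Ω → Fin 4} (hE : IsSwitchingChain P E) (n : ℕ)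
    (F : (ℕ → Fin 4) → ℝ) (hF : ∀ e e', (∀ i ≤ n, e i = e' i) → F e = F e') (f : Fin 4 → ℝ)
    (j : ℕ) :
    ∫ ω, F (fun i => E i ω) * (f (E (n + j) ω) - mean f) ∂P =
      (-(1 / 3)) ^ j * ∫ ω, F (fun i => E i ω) * (f (E n ω) - mean f) ∂P := by
  induction j with
  | zero => simp
  | succ j ih =>
    rw [← add_assoc, hE.integral_succ (n + j) F
      (fun e e' h => hF e e' fun i hi => h i (by omega)) f, ih]
    ring

/-- Freezing the second variable: independence allows to integrate it out last. -/
lemma integral_comp_of_indepFun {α β : Type*} [MeasurableSpace α] [MeasurableSpace β]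
    {X : Ω → α} {Y : Ω → β} (hX : Measurable X) (hY : Measurable Y) (h : IndepFun X Y P)
    (g : α → β → ℝ) (hg : Measurable (Function.uncurry g)) (C : ℝ) (hC : ∀ a b, |g a b| ≤ C) :
    ∫ ω, g (X ω) (Y ω) ∂P = ∫ ω, ∫ ω', g (X ω') (Y ω) ∂P ∂P := by
  have h1 := (indepFun_iff_map_prod_eq_prod_map_map hX.aemeasurable hY.aemeasurable).1 h
  have := Measure.isProbabilityMeasure_map (μ := P) hX.aemeasurable
  have := Measure.isProbabilityMeasure_map (μ := P) hY.aemeasurable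
  have h2 : ∫ ω, g (X ω) (Y ω) ∂P = ∫ z, Function.uncurry g z ∂(P.map fun ω => (X ω, Y ω)) := by
    rw [integral_map (hX.prodMk hY).aemeasurable hg.aestronglyMeasurable]
    rfl
  have hi : Integrable (Function.uncurry g) ((P.map X).prod (P.map Y)) :=
    Integrable.of_bound hg.aestronglyMeasurable C (ae_of_all _ fun z => hC z.1 z.2)
  rw [h2, h1, integral_prod_symm _ hi, integral_map hY.aemeasurable]
  · refine integral_congr_ae (ae_of_all _ fun ω => ?_)
    simp only
    rw [integral_map hX.aemeasurable]
    · rfl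
    · exact (hg.comp measurable_prodMk_right).aestronglyMeasurable
  · exact hi.integral_prod_right.aestronglyMeasurable

end Chain

/-! ### Poisson counts on a grid and the Markov property for a sampled past. -/

section Grid

variable {Ω : Type*} [MeasurableSpace Ω] {P : Measure Ω} {lam : ℝ → ℝ} {T : Ω → Set ℝ}
  {D : ℝ → Ω → Fin 4}

lemma IsPoissonProcess.count_add (hT : IsPoissonProcess P lam T) {a b d : ℝ} (ha : 0 ≤ a)
    (hab : a ≤ b) (hbd : b ≤ d) (hi : IntegrableOn lam (Ioc a d)) (ω : Ω) :
    count T a d ω = count T a b ω + count T b d ω := by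
  unfold count
  rw [← Ioc_union_Ioc_eq_Ioc hab hbd, inter_union_distrib_left]
  exact ncard_union_eq ((Ioc_disjoint_Ioc_of_le le_rfl).mono inter_subset_right inter_subset_right)
    (hT.finite a b ha (hi.mono_set (Ioc_subset_Ioc_right hbd)) ω)
    (hT.finite b d (ha.trans hab) (hi.mono_set (Ioc_subset_Ioc_left hab)) ω)

lemma count_self {Ω : Type*} (T : Ω → Set ℝ) (a : ℝ) (ω : Ω) : count T a a ω = 0 := by simp [count]

lemma IsPoissonProcess.count_eq_sum (hT : IsPoissonProcess P lam T) {u : ℕ → ℝ} (hu : Monotone u)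
    (h0 : 0 ≤ u 0) (n : ℕ) (hi : IntegrableOn lam (Ioc (u 0) (u n))) (ω : Ω) :
    count T (u 0) (u n) ω = ∑ i ∈ Finset.range n, count T (u i) (u (i + 1)) ω := by
  induction n with
  | zero => simp [count_self]
  | succ n ih =>
    rw [Finset.sum_range_succ, ← ih (hi.mono_set (Ioc_subset_Ioc_right (hu n.le_succ))),
      hT.count_add h0 (hu n.zero_le) (hu n.le_succ) hi]

/-- The cumulative counts up to `u n` are sums of increments among which the last one does not
occur, so grouping the independent increments suffices. -/
lemma IsPoissonProcess.indepFun_grid [IsProbabilityMeasure P] (hT : IsPoissonProcess P lam T)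
    {u : ℕ → ℝ}
    (hu : Monotone u) (h0 : 0 ≤ u 0) (n : ℕ) (hi : IntegrableOn lam (Ioc (u 0) (u (n + 1)))) :
    IndepFun (fun ω (i : Fin (n + 1)) => count T (u 0) (u i) ω)
      (count T (u n) (u (n + 1))) P := by
  have h := hT.indep (n + 1) (fun i => u i) (fun i j hij => hu hij) h0 (by simpa using hi)
  have hm : ∀ i : Fin (n + 1), Measurable
      (count T (u (i.castSucc : Fin (n + 2))) (u (i.succ : Fin (n + 2)))) := by
    intro i
    refine hT.measurable _ _ (h0.trans (hu (Nat.zero_le _))) (hi.mono_set ?_)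
    exact Ioc_subset_Ioc (hu (Nat.zero_le _)) (hu (by simp; omega))
  have h1 := h.indepFun_finset (Finset.univ.filter fun i => i ≠ Fin.last n) {Fin.last n}
    (by simp [Finset.disjoint_singleton_right]) hm
  -- The cumulative count at index `i` is the sum of the increments with index below `i`.
  have h2 := h1.comp
    (φ := fun (x : _ → ℕ) (i : Fin (n + 1)) => ∑ j : (Finset.univ.filter fun i => i ≠ Fin.last n),
      if (j : Fin (n + 1)) < i then x j else 0)
    (ψ := fun (x : _ → ℕ) => x ⟨Fin.last n, by simp⟩) Measurable.of_discrete Measurable.of_discrete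
  convert h2 using 1
  · funext ω i
    simp only [Function.comp]
    rw [hT.count_eq_sum hu h0 i (hi.mono_set (Ioc_subset_Ioc_right (hu (by omega))))]
    rw [Finset.sum_coe_sort (Finset.univ.filter fun i => i ≠ Fin.last n)
      (fun j : Fin (n + 1) => if j < i then count T (u (j.castSucc : Fin (n + 2)))
        (u (j.succ : Fin (n + 2))) ω else 0), ← Finset.sum_filter]
    refine Finset.sum_bij' (i := fun j hj => (⟨j, by simp at hj; omega⟩ : Fin (n + 1)))
      (j := fun j _ => (j : ℕ)) ?_ ?_ ?_ ?_ ?_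
    · intro j hj
      simp at hj ⊢
      refine ⟨?_, hj⟩
      intro h
      rw [Fin.ext_iff] at h
      simp at h
      omega
    · intro j hj
      simp at hj ⊢
      exact hj.2
    · intros; rfl
    · intros; rfl
    · intros; rfl
  · funext ω
    simp

lemma integral_pow_poisson (r : ℝ≥0) (x : ℝ) :
    ∫ n, x ^ n ∂(poissonMeasure r) = Real.exp (-(r * (1 - x))) := by
  rw [integral_poissonMeasure]
  have h := (NormedSpace.expSeries_div_hasSum_exp (r * x : ℝ)).mul_left (Real.exp (-r))
  rw [← Real.exp_eq_exp_ℝ, ← Real.exp_add] at h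
  rw [show -((r : ℝ) * (1 - x)) = -r + r * x by ring, ← h.tsum_eq]
  congr 1
  funext n
  rw [smul_eq_mul, mul_pow]
  ring

lemma IsPoissonProcess.integral_pow_count (hT : IsPoissonProcess P lam T) {a b : ℝ} (ha : 0 ≤ a)
    (hab : a ≤ b) (hi : IntegrableOn lam (Ioc a b)) (hl : 0 ≤ ∫ s in a..b, lam s) (x : ℝ) :
    ∫ ω, x ^ count T a b ω ∂P = Real.exp (-((∫ s in a..b, lam s) * (1 - x))) := by
  rw [← integral_map (φ := count T a b) (f := fun n => x ^ n) (hT.measurable a b ha hi).aemeasurable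
    (by exact Measurable.of_discrete.aestronglyMeasurable), hT.law a b ha hab hi,
    integral_pow_poisson, Real.coe_toNNReal _ hl]

lemma IsPoissonProcess.real_count_ne_zero_le [IsProbabilityMeasure P]
    (hT : IsPoissonProcess P lam T) {a b : ℝ}
    (ha : 0 ≤ a) (hab : a ≤ b) (hi : IntegrableOn lam (Ioc a b)) (hl : 0 ≤ ∫ s in a..b, lam s) :
    P.real {ω | count T a b ω ≠ 0} ≤ ∫ s in a..b, lam s := by
  have hm := hT.measurable a b ha hi
  have h0 : P.real {ω | count T a b ω = 0} = Real.exp (-∫ s in a..b, lam s) := by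
    have : {ω | count T a b ω = 0} = count T a b ⁻¹' {0} := rfl
    rw [this, ← map_measureReal_apply hm (measurableSet_singleton _), hT.law a b ha hab hi,
      poissonMeasure_real_singleton, Real.coe_toNNReal _ hl]
    simp
  have h1 : {ω | count T a b ω ≠ 0} = {ω | count T a b ω = 0}ᶜ := rfl
  have h2 : MeasurableSet {ω | count T a b ω = 0} := hm (measurableSet_singleton 0)
  rw [h1, probReal_compl_eq_one_sub h2, h0]
  linarith [Real.add_one_le_exp (-∫ s in a..b, lam s)]

/-- The directions at grid times are the chain read at random indices. Since the chain is
independent of all counts, the counts can be frozen and the chain contracted by `(-1/3) ^ N`; then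
`N` is independent of the earlier counts and is averaged out separately. -/
lemma markov_grid [IsProbabilityMeasure P] (hT : IsPoissonProcess P lam T) {u : ℕ → ℝ}
    (hu : Monotone u)
    (h0 : 0 ≤ u 0) (n : ℕ) (hi : IntegrableOn lam (Ioc (u 0) (u (n + 1))))
    (hl : 0 ≤ ∫ s in u n..u (n + 1), lam s) (hD : SwitchesUniformlyFrom P T D (u 0))
    (Φ : (Fin (n + 1) → Fin 4) → ℝ) (f : Fin 4 → ℝ) :
    ∫ ω, Φ (fun i => D (u i) ω) * (f (D (u (n + 1)) ω) - mean f) ∂P =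
      Real.exp (-(4 / 3 * ∫ s in u n..u (n + 1), lam s)) *
        ∫ ω, Φ (fun i => D (u i) ω) * (f (D (u n) ω) - mean f) ∂P := by
  obtain ⟨E, hE, hind, hDE⟩ := hD
  have hmE := hE.measurable
  have hu0 : ∀ i, u 0 ≤ u i := fun i => hu (Nat.zero_le i)
  have hi' : ∀ i ≤ n + 1, IntegrableOn lam (Ioc (u 0) (u i)) := fun i h =>
    hi.mono_set (Ioc_subset_Ioc_right (hu h))
  set K : Ω → Fin (n + 1) → ℕ := fun ω i => count T (u 0) (u i) ω with hK
  set N : Ω → ℕ := count T (u n) (u (n + 1)) with hN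
  have hin : IntegrableOn lam (Ioc (u n) (u (n + 1))) := hi.mono_set (Ioc_subset_Ioc_left (hu0 n))
  have hmN : Measurable N := hT.measurable _ _ (h0.trans (hu0 n)) hin
  have hmK : Measurable K := measurable_pi_lambda _ fun i =>
    hT.measurable _ _ h0 (hi' i (by omega))
  have hKN : IndepFun K N P := hT.indepFun_grid hu h0 n hi
  have hsum : ∀ ω, count T (u 0) (u (n + 1)) ω = K ω (Fin.last n) + N ω := fun ω =>
    hT.count_add h0 (hu0 n) (hu n.le_succ) hi ω
  -- `N` is recovered from the cumulative counts by a subtraction in `ℕ`, which is exact because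
  -- these counts increase.
  have hEKN : IndepFun (fun ω k => E k ω) (fun ω => (K ω, N ω)) P := by
    have hm : Measurable fun x : Ici (u 0) → ℕ => (((fun i => x ⟨u i, hu0 i⟩) : Fin (n + 1) → ℕ),
        (x ⟨u (n + 1), hu0 _⟩ - x ⟨u n, hu0 _⟩ : ℕ)) :=
      Measurable.prodMk (by fun_prop)
        (Measurable.comp (g := fun z : ℕ × ℕ => z.1 - z.2)
          (f := fun x : Ici (u 0) → ℕ => (x ⟨u (n + 1), hu0 _⟩, x ⟨u n, hu0 _⟩))
          Measurable.of_discrete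
          ((measurable_pi_apply _).prodMk (measurable_pi_apply _)))
    have h1 := hind.comp (φ := id) measurable_id hm
    refine h1.congr (Eventually.of_forall fun _ => rfl) (Eventually.of_forall fun ω => ?_)
    refine Prod.ext rfl ?_
    simp only [Function.comp]
    have := hsum ω
    simp only [hK, Fin.val_last] at this
    omega
  have hmono : ∀ ω (i : Fin (n + 1)), K ω i ≤ K ω (Fin.last n) := by
    intro ω i
    simp only [hK, Fin.val_last]
    rw [hT.count_add h0 (hu0 i) (hu (Nat.lt_succ_iff.1 i.2)) (hi' n (by omega))]
    omega
  obtain ⟨CΦ, hCΦ⟩ : ∃ C, ∀ d, |Φ d| ≤ C :=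
    ⟨∑ d, |Φ d|, fun d => Finset.single_le_sum (f := fun d => |Φ d|) (fun _ _ => abs_nonneg _)
      (Finset.mem_univ d)⟩
  obtain ⟨Cf, hCf⟩ : ∃ C, ∀ d, |f d - mean f| ≤ C :=
    ⟨∑ d, |f d - mean f|, fun d => Finset.single_le_sum (f := fun d => |f d - mean f|)
      (fun _ _ => abs_nonneg _) (Finset.mem_univ d)⟩
  set h : (Fin (n + 1) → ℕ) → ℝ := fun k =>
    ∫ ω', Φ (fun i => E (k i) ω') * (f (E (k (Fin.last n)) ω') - mean f) ∂P with hh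
  have hbd : ∀ d k, |Φ d * (f k - mean f)| ≤ CΦ * Cf := fun d k => by
    rw [abs_mul]
    exact mul_le_mul (hCΦ _) (hCf _) (abs_nonneg _) ((abs_nonneg _).trans (hCΦ d))
  -- This is applied both to `j = N` and to `j = 0`, so that the two sides of the claim are
  -- expressed through the same function `h` of the past counts.
  have frozen : ∀ j : Ω → ℕ, Measurable j → (IndepFun (fun ω k => E k ω)
      (fun ω => (K ω, j ω)) P) →
      ∫ ω, Φ (fun i => E (K ω i) ω) * (f (E (K ω (Fin.last n) + j ω) ω) - mean f) ∂P =
        ∫ ω, (-(1 / 3)) ^ (j ω) * h (K ω) ∂P := by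
    intro j hj hind'
    rw [integral_comp_of_indepFun (X := fun ω k => E k ω) (Y := fun ω => (K ω, j ω))
      (measurable_pi_lambda _ hmE) (hmK.prodMk hj) hind'
      (fun e z => Φ (fun i => e (z.1 i)) * (f (e (z.1 (Fin.last n) + z.2)) - mean f))
      (by
        refine measurable_from_prod_countable_left fun z => ?_
        refine Measurable.mul ?_ ?_
        · exact (Measurable.of_discrete (f := Φ)).comp
            (measurable_pi_lambda _ fun i => measurable_pi_apply (z.1 i))
        · exact (Measurable.of_discrete (f := fun k => f k - mean f)).comp
            (measurable_pi_apply (z.1 (Fin.last n) + z.2))) (CΦ * Cf) (fun e z => hbd _ _)]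
    refine integral_congr_ae (ae_of_all _ fun ω => ?_)
    simp only [hh]
    refine hE.integral_add (K ω (Fin.last n)) (fun e => Φ fun i => e (K ω i)) ?_ f (j ω)
    intro e e' hee
    refine congrArg Φ (funext fun i => ?_)
    exact hee _ (hmono ω i)
  have hDK : ∀ ω (i : Fin (n + 1)), D (u i) ω = E (K ω i) ω := fun ω i => hDE _ (hu0 i) ω
  have e1 := frozen N hmN hEKN
  have e2 := frozen (fun _ => 0) measurable_const (by
    exact hEKN.comp (φ := id) (ψ := fun z => (z.1, 0)) measurable_id (by fun_prop))
  simp only [pow_zero, one_mul, add_zero] at e2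
  have e3 : ∫ ω, (-(1 / 3) : ℝ) ^ (N ω) * h (K ω) ∂P =
      (∫ ω, (-(1 / 3) : ℝ) ^ (N ω) ∂P) * ∫ ω, h (K ω) ∂P := by
    refine IndepFun.integral_fun_mul_eq_mul_integral (hKN.symm.comp (φ := fun n => (-(1 / 3) : ℝ) ^ n)
      (ψ := h) Measurable.of_discrete Measurable.of_discrete) ?_ ?_
    · exact ((Measurable.of_discrete (f := fun n => (-(1 / 3) : ℝ) ^ n)).comp
        hmN).aestronglyMeasurable
    · exact ((Measurable.of_discrete (f := h)).comp hmK).aestronglyMeasurable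
  -- The generating function at `-1/3` produces the exponent `1 - (-1/3) = 4/3`.
  have e4 := hT.integral_pow_count (h0.trans (hu0 n)) (hu n.le_succ) hin hl (-(1 / 3))
  have hlhs : ∀ ω, D (u (n + 1)) ω = E (K ω (Fin.last n) + N ω) ω := fun ω => by
    rw [hDE _ (hu0 _) ω, hsum]
  have hn : ∀ ω, D (u n) ω = E (K ω (Fin.last n)) ω := fun ω => hDK ω (Fin.last n)
  simp only [hDK, hlhs, hn]
  rw [e1, e2, e3, e4]
  congr 2
  ring

end Grid

/-! ### Riemann sums of right-continuous functions. -/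

section RiemannSum

/-- Rounding up approaches `q` from the right, where the direction process is continuous. Using `m +
1` cells avoids division by zero. -/
lemma tendsto_ceil_grid {s : ℝ} (hs : 0 < s) (q : ℝ) :
    Tendsto (fun m : ℕ => (⌈q * (m + 1) / s⌉ : ℝ) * (s / (m + 1))) atTop (𝓝[≥] q) := by
  have hpos : ∀ m : ℕ, (0 : ℝ) < m + 1 := fun m => by positivity
  have hle : ∀ m : ℕ, q ≤ (⌈q * (m + 1) / s⌉ : ℝ) * (s / (m + 1)) := fun m => by
    calc q = q * (m + 1) / s * (s / (m + 1)) := by field_simp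
      _ ≤ _ := by gcongr; exact Int.le_ceil _
  refine tendsto_nhdsWithin_iff.2 ⟨?_, Eventually.of_forall hle⟩
  refine tendsto_of_tendsto_of_tendsto_of_le_of_le (h := fun m : ℕ => q + s * (1 / (m + 1)))
    tendsto_const_nhds ?_ hle fun m => ?_
  · simpa using (tendsto_one_div_add_atTop_nhds_zero_nat (𝕜 := ℝ)).const_mul s |>.const_add q
  · calc (⌈q * (m + 1) / s⌉ : ℝ) * (s / (m + 1)) ≤ (q * (m + 1) / s + 1) * (s / (m + 1)) := by
          gcongr
          exact (Int.ceil_lt_add_one _).le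
      _ = q + s * (1 / (m + 1)) := by field_simp

lemma aestronglyMeasurable_of_rightContinuous {h : ℝ → ℝ}
    (hr : ∀ q, 0 < q → ContinuousWithinAt h (Ici q) q) :
    AEStronglyMeasurable h (volume.restrict (Ioi 0)) := by
  refine aestronglyMeasurable_of_tendsto_ae atTop
    (f := fun (m : ℕ) (q : ℝ) => h ((⌈q * (m + 1) / 1⌉ : ℝ) * (1 / (m + 1)))) (fun m => ?_) ?_
  · exact ((Measurable.of_discrete (f := fun z : ℤ => h ((z : ℝ) * (1 / (m + 1))))).comp
      (by fun_prop : Measurable fun q : ℝ => ⌈q * (m + 1) / 1⌉)).aestronglyMeasurable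
  · filter_upwards [ae_restrict_mem measurableSet_Ioi] with q hq
    exact (hr q hq).tendsto.comp (tendsto_ceil_grid one_pos q)

lemma intervalIntegrable_of_rightContinuous {h : ℝ → ℝ} {C : ℝ} (hC : ∀ q, |h q| ≤ C)
    (hr : ∀ q, 0 < q → ContinuousWithinAt h (Ici q) q) {a b : ℝ} (ha : 0 ≤ a) (hb : 0 ≤ b) :
    IntervalIntegrable h volume a b := by
  rw [intervalIntegrable_iff]
  have : IsFiniteMeasure (volume.restrict (uIoc a b)) := ⟨by simp [uIoc]⟩
  refine Integrable.of_bound (C := C) ?_ (ae_of_all _ hC)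
  exact (aestronglyMeasurable_of_rightContinuous hr).mono_set
    fun x (hx : x ∈ Ioc (min a b) (max a b)) => (le_min ha hb).trans_lt hx.1

/-- A sum over right endpoints is the integral of `h` composed with rounding up to the grid, so
dominated convergence applies. -/
lemma tendsto_riemannSum {h : ℝ → ℝ} {C : ℝ} (hC : ∀ q, |h q| ≤ C)
    (hr : ∀ q, 0 < q → ContinuousWithinAt h (Ici q) q) {s : ℝ} (hs : 0 < s) :
    Tendsto (fun m : ℕ => ∑ i ∈ Finset.range (m + 1), s / (m + 1) * h ((i + 1) * (s / (m + 1))))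
      atTop (𝓝 (∫ q in 0..s, h q)) := by
  have hm : ∀ m : ℕ, Measurable fun q : ℝ => h ((⌈q * (m + 1) / s⌉ : ℝ) * (s / (m + 1))) :=
    fun m => (Measurable.of_discrete (f := fun z : ℤ => h ((z : ℝ) * (s / (m + 1))))).comp
      (by fun_prop : Measurable fun q : ℝ => ⌈q * (m + 1) / s⌉)
  have hsum : ∀ m : ℕ, ∑ i ∈ Finset.range (m + 1), s / (m + 1) * h ((i + 1) * (s / (m + 1))) =
      ∫ q in 0..s, h ((⌈q * (m + 1) / s⌉ : ℝ) * (s / (m + 1))) := by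
    intro m
    have hpos : (0 : ℝ) < m + 1 := by positivity
    have h1 := intervalIntegral.sum_integral_adjacent_intervals (μ := volume)
      (f := fun q : ℝ => h ((⌈q * (m + 1) / s⌉ : ℝ) * (s / (m + 1))))
      (a := fun i : ℕ => i * (s / (m + 1))) (n := m + 1) (fun k _ => by
        rw [intervalIntegrable_iff]
        exact Measure.integrableOn_of_bounded (M := C) (by simp) (hm m).aestronglyMeasurable
          (ae_of_all _ fun _ => hC _))
    simp only [Nat.cast_zero, zero_mul] at h1
    rw [show ((m + 1 : ℕ) : ℝ) * (s / (m + 1)) = s by push_cast; field_simp] at h1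
    rw [← h1]
    refine Finset.sum_congr rfl fun i _ => ?_
    have h2 : ∫ q in (i * (s / (m + 1)) : ℝ)..((i + 1 : ℕ) * (s / (m + 1)) : ℝ),
        h ((⌈q * (m + 1) / s⌉ : ℝ) * (s / (m + 1))) =
        ∫ q in (i * (s / (m + 1)) : ℝ)..((i + 1 : ℕ) * (s / (m + 1)) : ℝ),
          h ((i + 1) * (s / (m + 1))) := by
      have hle : (i * (s / (m + 1)) : ℝ) ≤ ((i + 1 : ℕ) * (s / (m + 1)) : ℝ) := by
        push_cast; gcongr; linarith
      rw [intervalIntegral.integral_of_le hle, intervalIntegral.integral_of_le hle]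
      refine setIntegral_congr_fun measurableSet_Ioc fun q hq => ?_
      have : ⌈q * (m + 1) / s⌉ = (i + 1 : ℤ) := by
        rw [Int.ceil_eq_iff]
        push_cast
        have h3 := hq.1
        have h4 := hq.2
        push_cast at h4
        rw [← mul_div_assoc, div_lt_iff₀ hpos] at h3
        rw [← mul_div_assoc, le_div_iff₀ hpos] at h4
        constructor
        · rw [lt_div_iff₀ hs]; linarith
        · rw [div_le_iff₀ hs]; linarith
      simp only [this]
      push_cast
      rfl
    rw [h2, intervalIntegral.integral_const, smul_eq_mul]
    push_cast
    ring
  simp only [hsum]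
  refine intervalIntegral.tendsto_integral_filter_of_dominated_convergence (fun _ => C)
    (Eventually.of_forall fun m => (hm m).aestronglyMeasurable)
    (Eventually.of_forall fun m => ae_of_all _ fun q _ => hC _) (by simp)
    (ae_of_all _ fun q hq => ?_)
  rw [uIoc_of_le hs.le] at hq
  exact (hr q hq.1).tendsto.comp (tendsto_ceil_grid hs q)

end RiemannSum

/-! ### Integrability of the rate, on intervals away from `0` and up to `0`. -/

section Rate

variable {lam : ℝ → ℝ}

lemma integrableOn_rate (hlam : ContinuousOn lam (Ioi 0)) {a b : ℝ} (ha : 0 < a) :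
    IntegrableOn lam (Ioc a b) :=
  ((hlam.mono fun _ hx => ha.trans_le hx.1).integrableOn_Icc).mono_set Ioc_subset_Icc_self

lemma intervalIntegrable_rate (hlam : ContinuousOn lam (Ioi 0)) {a b : ℝ} (ha : 0 < a)
    (hb : 0 < b) : IntervalIntegrable lam volume a b :=
  ⟨integrableOn_rate hlam ha, integrableOn_rate hlam hb⟩

lemma integrableOn_rate_zero (hlam : ContinuousOn lam (Ioi 0)) {t : ℝ} (ht : 0 < t)
    (h : IntegrableOn lam (Ioc 0 t)) (b : ℝ) : IntegrableOn lam (Ioc 0 b) :=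
  (h.union (integrableOn_rate hlam ht (b := b))).mono_set Ioc_subset_Ioc_union_Ioc

lemma integral_rate_nonneg (hpos : ∀ t, 0 < t → 0 ≤ lam t) {a b : ℝ} (ha : 0 ≤ a) (hab : a ≤ b) :
    0 ≤ ∫ s in a..b, lam s := by
  rw [intervalIntegral.integral_of_le hab]
  exact setIntegral_nonneg measurableSet_Ioc fun x hx => hpos x (ha.trans_lt hx.1)

end Rate

/-! ### Regularity of the paths and the Markov property given the position. -/

/-- The position at time `t` of the particle that starts at the origin and moves with velocity
`c * v k` while its direction is `k`. -/
noncomputable def pos {Ω : Type*} (c : ℝ) (v : Fin 4 → ℝ) (D : ℝ → Ω → Fin 4) (t : ℝ) (ω : Ω) : ℝ :=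
  ∫ s in 0..t, c * v (D s ω)

section Paths

variable {Ω : Type*} [MeasurableSpace Ω] {P : Measure Ω} {lam : ℝ → ℝ} {T : Ω → Set ℝ}
  {D : ℝ → Ω → Fin 4}

/-- This treats the two start conventions at once: whether or not the events accumulate at `0`, the
switching description is available from some time as small as desired. -/
lemma IsReflectingDirection.exists_start (hD : IsReflectingDirection P lam T D)
    (hlam : ContinuousOn lam (Ioi 0)) {ε : ℝ} (hε : 0 < ε) :
    ∃ s, 0 ≤ s ∧ s ≤ ε ∧ SwitchesUniformlyFrom P T D s ∧ ∀ b, IntegrableOn lam (Ioc s b) := by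
  by_cases h : ∀ t, 0 < t → IntegrableOn lam (Ioc 0 t) volume
  · exact ⟨0, le_rfl, hε.le, hD.start_zero h, integrableOn_rate_zero hlam one_pos (h 1 one_pos)⟩
  · exact ⟨ε, hε.le, le_rfl, hD.start_pos h ε hε, fun b => integrableOn_rate hlam hε⟩

lemma IsPoissonProcess.direction_eq (hT : IsPoissonProcess P lam T) {s₀ s r : ℝ} (h0 : 0 ≤ s₀)
    (hi : ∀ b, IntegrableOn lam (Ioc s₀ b)) (hs : SwitchesUniformlyFrom P T D s₀)
    (h1 : s₀ ≤ s) (h2 : s ≤ r) {ω : Ω} (hc : count T s r ω = 0) : D r ω = D s ω := by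
  obtain ⟨E, -, -, hE⟩ := hs
  rw [hE r (h1.trans h2), hE s h1, hT.count_add h0 h1 h2 (hi r), hc, add_zero]

lemma IsReflectingDirection.direction_eq (hD : IsReflectingDirection P lam T D)
    (hlam : ContinuousOn lam (Ioi 0)) {s r : ℝ} (hs : 0 < s) (hr : s ≤ r) {ω : Ω}
    (hc : count T s r ω = 0) : D r ω = D s ω := by
  obtain ⟨s₀, h0, hle, hsw, hi⟩ := hD.exists_start hlam hs
  exact hD.poisson.direction_eq h0 hi hsw hle hr hc

lemma IsPoissonProcess.count_eq_zero_of_le (hT : IsPoissonProcess P lam T) {s r q : ℝ} (h0 : 0 ≤ s)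
    (hi : IntegrableOn lam (Ioc s r)) (hq : q ≤ r) {ω : Ω} (hc : count T s r ω = 0) :
    count T s q ω = 0 := by
  unfold count at hc ⊢
  rw [ncard_eq_zero (hT.finite s r h0 hi ω)] at hc
  rw [subset_empty_iff.1 ((inter_subset_inter_right _ (Ioc_subset_Ioc_right hq)).trans hc.subset),
    ncard_empty]

lemma IsPoissonProcess.measurable_direction (hT : IsPoissonProcess P lam T) {s₀ t : ℝ}
    (h0 : 0 ≤ s₀) (hi : ∀ b, IntegrableOn lam (Ioc s₀ b)) (hs : SwitchesUniformlyFrom P T D s₀)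
    (ht : s₀ ≤ t) : Measurable (D t) := by
  obtain ⟨E, hE, -, hDE⟩ := hs
  have h1 : Measurable fun ω => ((fun k => E k ω), count T s₀ t ω) :=
    (measurable_pi_lambda _ hE.measurable).prodMk (hT.measurable _ _ h0 (hi t))
  have h2 : Measurable fun z : (ℕ → Fin 4) × ℕ => z.1 z.2 :=
    measurable_from_prod_countable_left fun k => measurable_pi_apply k
  have h3 : D t = (fun z : (ℕ → Fin 4) × ℕ => z.1 z.2) ∘ fun ω => ((fun k => E k ω), count T s₀ t ω) := by
    funext ω
    exact hDE t ht ω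
  rw [h3]
  exact h2.comp h1

lemma IsReflectingDirection.measurable_direction (hD : IsReflectingDirection P lam T D)
    (hlam : ContinuousOn lam (Ioi 0)) {t : ℝ} (ht : 0 < t) : Measurable (D t) := by
  obtain ⟨s₀, h0, hle, hsw, hi⟩ := hD.exists_start hlam ht
  exact hD.poisson.measurable_direction h0 hi hsw hle

/-- Only finitely many events lie in `(q, q + 1]`, and an event at `q` itself is already counted in
`D q`. -/
lemma IsReflectingDirection.eventually_direction_eq (hD : IsReflectingDirection P lam T D)
    (hlam : ContinuousOn lam (Ioi 0)) {q : ℝ} (hq : 0 < q) (ω : Ω) :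
    ∀ᶠ r in 𝓝[≥] q, D r ω = D q ω := by
  have hf : (T ω ∩ Ioc q (q + 1)).Finite :=
    hD.poisson.finite q (q + 1) hq.le (integrableOn_rate hlam hq) ω
  have h1 : ∀ᶠ r in 𝓝[≥] q, ∀ x ∈ T ω ∩ Ioc q (q + 1), r < x :=
    (eventually_all_finite hf).2 fun x hx =>
      mem_nhdsWithin_of_mem_nhds (Iio_mem_nhds hx.2.1)
  have h2 : ∀ᶠ r in 𝓝[≥] q, r < q + 1 := mem_nhdsWithin_of_mem_nhds (Iio_mem_nhds (by linarith))
  filter_upwards [h1, h2, self_mem_nhdsWithin] with r hr1 hr2 hr3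
  refine hD.direction_eq hlam hq hr3 ?_
  have : T ω ∩ Ioc q r = ∅ := by
    rw [eq_empty_iff_forall_notMem]
    rintro x ⟨hx1, hx2⟩
    exact absurd (hr1 x ⟨hx1, hx2.1, hx2.2.trans hr2.le⟩) (not_lt.2 hx2.2)
  simp [count, this]

lemma IsReflectingDirection.continuousWithinAt (hD : IsReflectingDirection P lam T D)
    (hlam : ContinuousOn lam (Ioi 0)) (h : Fin 4 → ℝ) {q : ℝ} (hq : 0 < q) (ω : Ω) :
    ContinuousWithinAt (fun r => h (D r ω)) (Ici q) q :=
  tendsto_const_nhds.congr' <| by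
    filter_upwards [hD.eventually_direction_eq hlam hq ω] with r hr
    rw [hr]

lemma IsReflectingDirection.pos_sub_pos (hD : IsReflectingDirection P lam T D)
    (hlam : ContinuousOn lam (Ioi 0)) (c : ℝ) (v : Fin 4 → ℝ) {s r : ℝ} (hs : 0 ≤ s) (hr : 0 ≤ r)
    (ω : Ω) : pos c v D r ω - pos c v D s ω = ∫ q in s..r, c * v (D q ω) := by
  have hC : ∀ k : Fin 4, |c * v k| ≤ ∑ k, |c * v k| := fun k =>
    Finset.single_le_sum (f := fun k => |c * v k|) (fun _ _ => abs_nonneg _) (Finset.mem_univ k)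
  have h : ∀ {a b : ℝ}, 0 ≤ a → 0 ≤ b →
      IntervalIntegrable (fun q => c * v (D q ω)) volume a b := fun ha hb =>
    intervalIntegrable_of_rightContinuous (fun q => hC (D q ω))
      (fun q hq => hD.continuousWithinAt hlam (fun k => c * v k) hq ω) ha hb
  exact intervalIntegral.integral_interval_sub_left (h le_rfl hr) (h le_rfl hs)

lemma IsReflectingDirection.abs_pos_sub_pos_le (hD : IsReflectingDirection P lam T D)
    (hlam : ContinuousOn lam (Ioi 0)) {c : ℝ} (hc : 0 ≤ c) {v : Fin 4 → ℝ} (hv : ∀ k, |v k| ≤ 1)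
    {s r : ℝ} (hs : 0 ≤ s) (hr : s ≤ r) (ω : Ω) :
    |pos c v D r ω - pos c v D s ω| ≤ c * (r - s) := by
  rw [hD.pos_sub_pos hlam c v hs (hs.trans hr)]
  have := intervalIntegral.norm_integral_le_of_norm_le_const (a := s) (b := r) (C := c)
    (f := fun q => c * v (D q ω)) (fun q _ => by
      rw [Real.norm_eq_abs, abs_mul, abs_of_nonneg hc]
      exact mul_le_of_le_one_right hc (hv _))
  rwa [abs_of_nonneg (sub_nonneg.2 hr)] at this

lemma IsReflectingDirection.tendsto_pos (hD : IsReflectingDirection P lam T D)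
    (hlam : ContinuousOn lam (Ioi 0)) (c : ℝ) (v : Fin 4 → ℝ) {s : ℝ} (hs : 0 < s) (ω : Ω) :
    Tendsto (fun m : ℕ => ∑ i ∈ Finset.range (m + 1),
      s / (m + 1) * (c * v (D ((i + 1) * (s / (m + 1))) ω))) atTop (𝓝 (pos c v D s ω)) := by
  have hC : ∀ k : Fin 4, |c * v k| ≤ ∑ k, |c * v k| := fun k =>
    Finset.single_le_sum (f := fun k => |c * v k|) (fun _ _ => abs_nonneg _) (Finset.mem_univ k)
  exact tendsto_riemannSum (h := fun q => c * v (D q ω)) (fun q => hC (D q ω))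
    (fun q hq => hD.continuousWithinAt hlam (fun k => c * v k) hq ω) hs

lemma IsReflectingDirection.measurable_pos (hD : IsReflectingDirection P lam T D)
    (hlam : ContinuousOn lam (Ioi 0)) (c : ℝ) (v : Fin 4 → ℝ) {s : ℝ} (hs : 0 < s) :
    Measurable (pos c v D s) := by
  refine measurable_of_tendsto_metrizable (f := fun (m : ℕ) ω => ∑ i ∈ Finset.range (m + 1),
      s / (m + 1) * (c * v (D ((i + 1) * (s / (m + 1))) ω))) (fun m => ?_)
    (tendsto_pi_nhds.2 fun ω => hD.tendsto_pos hlam c v hs ω)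
  refine Finset.measurable_fun_sum _ fun i _ => ?_
  exact (Measurable.of_discrete (f := fun k => s / (m + 1) * (c * v k))).comp
    (hD.measurable_direction hlam (by positivity))

variable [IsProbabilityMeasure P]

/-- The Markov property of the direction, given the position at time `s`. -/
lemma IsReflectingDirection.markov (hD : IsReflectingDirection P lam T D)
    (hlam : ContinuousOn lam (Ioi 0)) (hpos : ∀ t, 0 < t → 0 ≤ lam t) (c : ℝ) (v : Fin 4 → ℝ)
    {s r : ℝ} (hs : 0 < s) (hr : s ≤ r) {g : ℝ → ℝ} (hg : Continuous g) {C : ℝ}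
    (hC : ∀ x, |g x| ≤ C) (f : Fin 4 → ℝ) :
    ∫ ω, g (pos c v D s ω) * (f (D r ω) - mean f) ∂P =
      Real.exp (-(4 / 3 * ∫ q in s..r, lam q)) *
        ∫ ω, g (pos c v D s ω) * (f (D s ω) - mean f) ∂P := by
  obtain ⟨Cf, hCf⟩ : ∃ C, ∀ d, |f d - mean f| ≤ C :=
    ⟨∑ d, |f d - mean f|, fun d => Finset.single_le_sum (f := fun d => |f d - mean f|)
      (fun _ _ => abs_nonneg _) (Finset.mem_univ d)⟩
  set S : ℕ → Ω → ℝ := fun m ω => ∑ i ∈ Finset.range (m + 1),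
      s / (m + 1) * (c * v (D ((i + 1) * (s / (m + 1))) ω)) with hS
  have hmD : ∀ t, 0 < t → Measurable fun ω => f (D t ω) - mean f := fun t ht =>
    (Measurable.of_discrete (f := fun k => f k - mean f)).comp (hD.measurable_direction hlam ht)
  have hmS : ∀ m, Measurable (S m) := fun m => Finset.measurable_fun_sum _ fun i _ =>
    (Measurable.of_discrete (f := fun k => s / (m + 1) * (c * v k))).comp
      (hD.measurable_direction hlam (by positivity))
  have lim : ∀ t, 0 < t → Tendsto (fun m => ∫ ω, g (S m ω) * (f (D t ω) - mean f) ∂P) atTop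
      (𝓝 (∫ ω, g (pos c v D s ω) * (f (D t ω) - mean f) ∂P)) := by
    intro t ht
    refine tendsto_integral_of_dominated_convergence (fun _ => C * Cf)
      (fun m => ((hg.measurable.comp (hmS m)).mul (hmD t ht)).aestronglyMeasurable)
      (integrable_const _) (fun m => ae_of_all _ fun ω => ?_) (ae_of_all _ fun ω => ?_)
    · rw [Real.norm_eq_abs, abs_mul]
      exact mul_le_mul (hC _) (hCf _) (abs_nonneg _) ((abs_nonneg _).trans (hC 0))
    · exact (((hg.tendsto _).comp (hD.tendsto_pos hlam c v hs ω))).mul_const _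
  have key : ∀ m, ∫ ω, g (S m ω) * (f (D r ω) - mean f) ∂P =
      Real.exp (-(4 / 3 * ∫ q in s..r, lam q)) * ∫ ω, g (S m ω) * (f (D s ω) - mean f) ∂P := by
    intro m
    have hm : (0 : ℝ) < m + 1 := by positivity
    obtain ⟨s₀, h0, hle, hsw, hi⟩ := hD.exists_start hlam (ε := s / (m + 1)) (by positivity)
    -- The grid consists of the auxiliary start `s₀`, the multiples of the mesh up to `s`, which has
    -- index `m + 1`, and finally `r`.
    set u : ℕ → ℝ := fun i => if i = 0 then s₀ else if i ≤ m + 1 then i * (s / (m + 1)) else r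
      with hu
    have hsm : ((m + 1 : ℕ) : ℝ) * (s / (m + 1)) = s := by push_cast; field_simp
    have humono : Monotone u := by
      refine monotone_nat_of_le_succ fun i => ?_
      simp only [hu]
      rcases Nat.eq_zero_or_pos i with rfl | hi0
      · simpa using hle
      · rw [if_neg hi0.ne', if_neg (Nat.succ_ne_zero i)]
        by_cases h1 : i + 1 ≤ m + 1
        · rw [if_pos (by omega), if_pos h1]
          push_cast
          gcongr
          linarith
        · rw [if_neg h1]
          split_ifs with h2
          · have : i = m + 1 := by omega
            rw [this, hsm]
            exact hr
          · exact le_rfl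
    have hu0 : u 0 = s₀ := by simp [hu]
    have hun : u (m + 1) = s := by simp only [hu]; rw [if_neg (by omega), if_pos le_rfl, hsm]
    have hur : u (m + 1 + 1) = r := by simp [hu]
    have hui : ∀ i, i < m + 1 → u (i + 1) = (i + 1) * (s / (m + 1)) := by
      intro i h
      simp only [hu]
      rw [if_neg (by omega), if_pos (by omega)]
      push_cast
      rfl
    have h := markov_grid hD.poisson humono (by rw [hu0]; exact h0) (m + 1)
      (by rw [hu0]; exact hi _) (by rw [hun, hur]; exact integral_rate_nonneg hpos hs.le hr)
      (by rw [hu0]; exact hsw)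
      -- Only right endpoints, hence indices `i.succ`, enter the Riemann sum; the direction at `s₀`
      -- is not used.
      (fun d => g (∑ i : Fin (m + 1), s / (m + 1) * (c * v (d i.succ)))) f
    rw [hun, hur] at h
    have hSd : ∀ ω, S m ω = ∑ i : Fin (m + 1), s / (m + 1) * (c * v (D (u i.succ) ω)) := by
      intro ω
      simp only [hS]
      rw [Finset.sum_range]
      refine Finset.sum_congr rfl fun i _ => ?_
      rw [Fin.val_succ, hui i i.2]
    simp only [hSd]
    exact h
  refine tendsto_nhds_unique (lim r (hs.trans_le hr)) ?_
  simp only [key]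
  exact (lim s hs).const_mul _

end Paths

/-! ### One-sided derivatives and Taylor bounds. -/

section RightDerivative

lemma hasDerivAt_integral_rate {lam : ℝ → ℝ} (hlam : ContinuousOn lam (Ioi 0)) {s r : ℝ}
    (hs : 0 < s) (hr : 0 < r) : HasDerivAt (fun q => ∫ x in s..q, lam x) (lam r) r :=
  intervalIntegral.integral_hasDerivAt_right (intervalIntegrable_rate hlam hs hr)
    (hlam.stronglyMeasurableAtFilter isOpen_Ioi r hr) (hlam.continuousAt (Ioi_mem_nhds hr))

/-- A continuous function with a continuous right derivative on `(0, ∞)` is differentiable. -/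
lemma hasDerivAt_of_hasDerivWithinAt_right {f g : ℝ → ℝ} (hf : ContinuousOn f (Ioi 0))
    (hg : ContinuousOn g (Ioi 0)) (h : ∀ s, 0 < s → HasDerivWithinAt f (g s) (Ioi s) s) {t : ℝ}
    (ht : 0 < t) : HasDerivAt f (g t) t := by
  have h1 := hasDerivAt_integral_rate hg (half_pos ht) ht
  refine (h1.add_const (f (t / 2))).congr_of_eventuallyEq ?_
  filter_upwards [Ioi_mem_nhds ht] with q hq
  have hsub : uIcc (t / 2) q ⊆ Ioi 0 := fun x hx => (lt_min (half_pos ht) hq).trans_le hx.1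
  -- The fundamental theorem of calculus needs only the right derivative, and the primitive of the
  -- continuous `g` is differentiable on both sides.
  rw [intervalIntegral.integral_eq_sub_of_hasDeriv_right (hf.mono hsub)
    (fun x hx => h x ((lt_min (half_pos ht) hq).trans hx.1))
    (intervalIntegrable_rate hg (half_pos ht) hq)]
  ring

/-- The mean value inequality is applied to `ψ` minus its tangent; a Lipschitz derivative replaces a
second derivative, so that antiderivatives of test functions can be handled alike. -/
lemma abs_taylor_le {ψ ψ' : ℝ → ℝ} {C : ℝ} (hψ : ∀ x, HasDerivAt ψ (ψ' x) x)
    (hL : ∀ x y, |ψ' x - ψ' y| ≤ C * |x - y|) (x h : ℝ) :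
    |ψ (x + h) - ψ x - h * ψ' x| ≤ C * h ^ 2 := by
  have h1 := (convex_uIcc x (x + h)).norm_image_sub_le_of_norm_hasDerivWithin_le
    (f := fun y => ψ y - y * ψ' x) (f' := fun y => ψ' y - ψ' x) (C := C * |h|) (x := x)
    (y := x + h) (fun y _ => ((hψ y).sub (by simpa using (hasDerivAt_id y).mul_const (ψ' x)))
      |>.hasDerivWithinAt)
    (fun y hy => by
      have hC : 0 ≤ C := by simpa using (abs_nonneg _).trans (hL 1 0)
      refine (hL y x).trans (mul_le_mul_of_nonneg_left ?_ hC)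
      have := abs_sub_left_of_mem_uIcc hy
      simpa using this) left_mem_uIcc right_mem_uIcc
  simp only [Real.norm_eq_abs, add_sub_cancel_left] at h1
  calc |ψ (x + h) - ψ x - h * ψ' x| = |ψ (x + h) - (x + h) * ψ' x - (ψ x - x * ψ' x)| := by
        congr 1; ring
    _ ≤ C * |h| * |h| := h1
    _ = C * h ^ 2 := by rw [mul_assoc, abs_mul_abs_self, sq]

lemma abs_sub_le_of_hasDerivAt {ψ ψ' : ℝ → ℝ} {C : ℝ} (hψ : ∀ x, HasDerivAt ψ (ψ' x) x)
    (hC : ∀ x, |ψ' x| ≤ C) (x y : ℝ) : |ψ x - ψ y| ≤ C * |x - y| :=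
  convex_univ.norm_image_sub_le_of_norm_hasDerivWithin_le
    (fun z _ => (hψ z).hasDerivWithinAt) (fun z _ => hC z) (mem_univ y) (mem_univ x)

end RightDerivative

/-! ### The Kolmogorov equation of an abstract Markov motion. -/

/-- The properties of the position `Z` and the direction `D` on which the analysis of the law of
the motion rests: paths of speed at most `c` which are straight between events, and the Markov
property for the direction. -/
structure IsMarkovMotion {Ω : Type*} [MeasurableSpace Ω] (P : Measure Ω) (c : ℝ) (lam : ℝ → ℝ)
    (v : Fin 4 → ℝ) (D : ℝ → Ω → Fin 4) (Z : ℝ → Ω → ℝ) : Prop where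
  speed_nonneg : 0 ≤ c
  rate_cont : ContinuousOn lam (Ioi 0)
  rate_nonneg : ∀ t, 0 < t → 0 ≤ lam t
  abs_velocity_le : ∀ k, |v k| ≤ 1
  measurable_direction : ∀ t, 0 < t → Measurable (D t)
  measurable_position : ∀ t, 0 < t → Measurable (Z t)
  lipschitz : ∀ s r, 0 < s → s ≤ r → ∀ ω, |Z r ω - Z s ω| ≤ c * (r - s)
  straight : ∀ s r, 0 < s → s ≤ r → ∃ N, MeasurableSet N ∧ P.real N ≤ ∫ q in s..r, lam q ∧
    ∀ ω, ω ∉ N → D r ω = D s ω ∧ Z r ω = Z s ω + c * v (D s ω) * (r - s)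
  markov : ∀ s r, 0 < s → s ≤ r → ∀ g : ℝ → ℝ, Continuous g → ∀ C, (∀ x, |g x| ≤ C) →
    ∀ f : Fin 4 → ℝ, ∫ ω, g (Z s ω) * (f (D r ω) - mean f) ∂P =
      Real.exp (-(4 / 3 * ∫ q in s..r, lam q)) * ∫ ω, g (Z s ω) * (f (D s ω) - mean f) ∂P

section Kolmogorov

variable {Ω : Type*} [MeasurableSpace Ω] {P : Measure Ω} {lam : ℝ → ℝ} {T : Ω → Set ℝ}
  {D : ℝ → Ω → Fin 4}

lemma IsReflectingDirection.isMarkovMotion [IsProbabilityMeasure P]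
    (hD : IsReflectingDirection P lam T D)
    (hlam : ContinuousOn lam (Ioi 0)) (hpos : ∀ t, 0 < t → 0 ≤ lam t) {c : ℝ} (hc : 0 ≤ c)
    {v : Fin 4 → ℝ} (hv : ∀ k, |v k| ≤ 1) : IsMarkovMotion P c lam v D (pos c v D) where
  speed_nonneg := hc
  rate_cont := hlam
  rate_nonneg := hpos
  abs_velocity_le := hv
  measurable_direction t ht := hD.measurable_direction hlam ht
  measurable_position t ht := hD.measurable_pos hlam c v ht
  lipschitz s r hs hr ω := hD.abs_pos_sub_pos_le hlam hc hv hs.le hr ω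
  straight s r hs hr := by
    have hi := integrableOn_rate hlam hs (b := r)
    refine ⟨{ω | count T s r ω ≠ 0}, ?_, hD.poisson.real_count_ne_zero_le hs.le hr hi
      (integral_rate_nonneg hpos hs.le hr), fun ω hω => ?_⟩
    · exact (hD.poisson.measurable s r hs.le hi) (measurableSet_singleton 0).compl
    · have h0 : count T s r ω = 0 := not_not.1 hω
      refine ⟨hD.direction_eq hlam hs hr h0, ?_⟩
      have h1 := hD.pos_sub_pos hlam c v hs.le (hs.le.trans hr) ω
      have h2 : ∫ q in s..r, c * v (D q ω) = ∫ q in s..r, c * v (D s ω) := by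
        refine intervalIntegral.integral_congr fun q hq => ?_
        rw [uIcc_of_le hr] at hq
        rw [hD.direction_eq hlam hs hq.1 (hD.poisson.count_eq_zero_of_le hs.le hi hq.2 h0)]
      rw [h2, intervalIntegral.integral_const, smul_eq_mul] at h1
      linarith
  markov s r hs hr g hg C hC f := hD.markov hlam hpos c v hs hr hg hC f

/-- The expectation of `ψ (Z q + κ q) f (D q)`. -/
noncomputable def observe (P : Measure Ω) (Z : ℝ → Ω → ℝ) (D : ℝ → Ω → Fin 4) (κ : ℝ) (ψ : ℝ → ℝ)
    (f : Fin 4 → ℝ) (q : ℝ) : ℝ :=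
  ∫ ω, ψ (Z q ω + κ * q) * f (D q ω) ∂P

variable {c : ℝ} {v : Fin 4 → ℝ} {Z : ℝ → Ω → ℝ}

namespace IsMarkovMotion

lemma abs_shift_sub_le (hM : IsMarkovMotion P c lam v D Z) (κ : ℝ) {s r : ℝ} (hs : 0 < s)
    (hr : s ≤ r) (ω : Ω) :
    |Z r ω + κ * r - (Z s ω + κ * s)| ≤ (c + |κ|) * (r - s) := by
  have h1 := hM.lipschitz s r hs hr ω
  have h2 : |κ * (r - s)| = |κ| * (r - s) := by rw [abs_mul, abs_of_nonneg (sub_nonneg.2 hr)]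
  calc _ = |(Z r ω - Z s ω) + κ * (r - s)| := by congr 1; ring
    _ ≤ _ := (abs_add_le _ _).trans (by rw [h2]; linarith)

lemma one_sub_exp_rate_mem (hM : IsMarkovMotion P c lam v D Z) {s r : ℝ} (hs : 0 < s)
    (hr : s ≤ r) : 0 ≤ 1 - Real.exp (-(4 / 3 * ∫ q in s..r, lam q)) ∧
      1 - Real.exp (-(4 / 3 * ∫ q in s..r, lam q)) ≤ 4 / 3 * ∫ q in s..r, lam q := by
  have h1 := integral_rate_nonneg hM.rate_nonneg hs.le hr
  have h2 := Real.add_one_le_exp (-(4 / 3 * ∫ q in s..r, lam q))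
  have h3 : Real.exp (-(4 / 3 * ∫ q in s..r, lam q)) ≤ 1 := Real.exp_le_one_iff.2 (by linarith)
  constructor <;> linarith

variable [IsProbabilityMeasure P]

lemma integrable_observe (hM : IsMarkovMotion P c lam v D Z) {ψ : ℝ → ℝ} {C : ℝ}
    (hψ : Continuous ψ) (hC : ∀ x, |ψ x| ≤ C) (f : Fin 4 → ℝ) {q s r : ℝ} (hq : 0 < q)
    (hr : 0 < r) : Integrable (fun ω => ψ (Z q ω + s) * f (D r ω)) P := by
  refine Integrable.of_bound (C := C * ∑ k, |f k|) ?_ (ae_of_all _ fun ω => ?_)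
  · exact ((hψ.measurable.comp ((hM.measurable_position q hq).add_const s)).mul
      ((Measurable.of_discrete (f := f)).comp (hM.measurable_direction r hr))).aestronglyMeasurable
  · rw [Real.norm_eq_abs, abs_mul]
    exact mul_le_mul (hC _) (Finset.single_le_sum (f := fun k => |f k|)
      (fun _ _ => abs_nonneg _) (Finset.mem_univ _)) (abs_nonneg _) ((abs_nonneg _).trans (hC 0))

lemma abs_observe_le {ψ : ℝ → ℝ} {C : ℝ}
    (hC : ∀ x, |ψ x| ≤ C) {f : Fin 4 → ℝ} {F : ℝ} (hF : ∀ k, |f k| ≤ F) (κ q : ℝ) :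
    |observe P Z D κ ψ f q| ≤ C * F := by
  have := norm_integral_le_of_norm_le_const (μ := P) (C := C * F)
    (f := fun ω => ψ (Z q ω + κ * q) * f (D q ω)) (ae_of_all _ fun ω => by
      rw [Real.norm_eq_abs, abs_mul]
      exact mul_le_mul (hC _) (hF _) (abs_nonneg _) ((abs_nonneg _).trans (hC 0)))
  simpa [observe] using this

/-- The increment is split by moving the position first, with the direction at time `r` kept, and
then changing the direction with the position frozen at time `s`. The second part is given exactly
by the Markov property. -/
lemma observe_sub (hM : IsMarkovMotion P c lam v D Z) {ψ : ℝ → ℝ} {C : ℝ}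
    (hψ : Continuous ψ) (hC : ∀ x, |ψ x| ≤ C) (f : Fin 4 → ℝ) (κ : ℝ) {s r : ℝ} (hs : 0 < s)
    (hr : s ≤ r) :
    observe P Z D κ ψ f r - observe P Z D κ ψ f s =
      ∫ ω, (ψ (Z r ω + κ * r) - ψ (Z s ω + κ * s)) * f (D r ω) ∂P +
      (1 - Real.exp (-(4 / 3 * ∫ q in s..r, lam q))) *
        (mean f * observe P Z D κ ψ (fun _ => 1) s - observe P Z D κ ψ f s) := by
  have hr0 := hs.trans_le hr
  have h1 := hM.markov s r hs hr (fun x => ψ (x + κ * s)) (by fun_prop) C (fun x => hC _) f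
  have i1 := fun f => hM.integrable_observe hψ hC f (q := s) (s := κ * s) hs hs
  have i2 := fun f => hM.integrable_observe hψ hC f (q := s) (s := κ * s) hs hr0
  have i3 := fun f => hM.integrable_observe hψ hC f (q := r) (s := κ * r) hr0 hr0
  have e1 : ∀ q, 0 < q → ∫ ω, ψ (Z s ω + κ * s) * (f (D q ω) - mean f) ∂P =
      ∫ ω, ψ (Z s ω + κ * s) * f (D q ω) ∂P - mean f * observe P Z D κ ψ (fun _ => 1) s := by
    intro q hq
    rw [observe, ← integral_const_mul, ← integral_sub]
    · congr 1
      funext ω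
      ring
    · exact hM.integrable_observe hψ hC f hs hq
    · exact (i1 fun _ => 1).const_mul _
  rw [e1 r hr0, e1 s hs] at h1
  have e2 : ∫ ω, (ψ (Z r ω + κ * r) - ψ (Z s ω + κ * s)) * f (D r ω) ∂P =
      observe P Z D κ ψ f r - ∫ ω, ψ (Z s ω + κ * s) * f (D r ω) ∂P := by
    rw [observe, ← integral_sub (i3 f) (i2 f)]
    congr 1
    funext ω
    ring
  rw [e2]
  change _ = _ * (observe P Z D κ ψ f s - _) at h1
  linear_combination h1

/-- Transport contributes at most a multiple of `r - s` by finite speed, switching at most a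
multiple of `∫ lam`; the bound serves to prove continuity in time. -/
lemma exists_abs_observe_sub_le (hM : IsMarkovMotion P c lam v D Z) {ψ : ℝ → ℝ} {C : ℝ}
    (hC : ∀ x, |ψ x| ≤ C) (hL : ∀ x y, |ψ x - ψ y| ≤ C * |x - y|) (f : Fin 4 → ℝ) (κ : ℝ) :
    ∃ K, 0 ≤ K ∧ ∀ s r, 0 < s → s ≤ r → |observe P Z D κ ψ f r - observe P Z D κ ψ f s| ≤
      K * ((r - s) + ∫ q in s..r, lam q) := by
  have hψ : Continuous ψ := by
    have hC0 : 0 ≤ C := (abs_nonneg _).trans (hC 0)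
    refine (LipschitzWith.of_dist_le_mul (K := ⟨C, hC0⟩) fun x y => ?_).continuous
    exact hL x y
  set F := ∑ k, |f k|
  have hF : ∀ k, |f k| ≤ F := fun k => Finset.single_le_sum (f := fun k => |f k|)
      (fun _ _ => abs_nonneg _) (Finset.mem_univ _)
  have hF0 : 0 ≤ F := (abs_nonneg _).trans (hF 0)
  have hC0 : 0 ≤ C := (abs_nonneg _).trans (hC 0)
  have hc := hM.speed_nonneg
  have hm0 := abs_nonneg (mean f)
  have hk0 := abs_nonneg κ
  refine ⟨C * (c + |κ|) * F + 4 / 3 * (|mean f| * (C * 1) + C * F), by positivity,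
    fun s r hs hr => ?_⟩
  rw [hM.observe_sub hψ hC f κ hs hr]
  have h1 : |∫ ω, (ψ (Z r ω + κ * r) - ψ (Z s ω + κ * s)) * f (D r ω) ∂P| ≤
      C * ((c + |κ|) * (r - s)) * F := by
    have := norm_integral_le_of_norm_le_const (μ := P) (C := C * ((c + |κ|) * (r - s)) * F)
      (f := fun ω => (ψ (Z r ω + κ * r) - ψ (Z s ω + κ * s)) * f (D r ω)) (ae_of_all _ fun ω => by
        rw [Real.norm_eq_abs, abs_mul]
        refine mul_le_mul ((hL _ _).trans ?_) (hF _) (abs_nonneg _) ?_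
        · exact mul_le_mul_of_nonneg_left (hM.abs_shift_sub_le κ hs hr ω) hC0
        · exact mul_nonneg hC0 (mul_nonneg (by positivity) (sub_nonneg.2 hr)))
    simpa using this
  obtain ⟨h2, h3⟩ := hM.one_sub_exp_rate_mem hs hr
  have h4 : |mean f * observe P Z D κ ψ (fun _ => 1) s - observe P Z D κ ψ f s| ≤
      |mean f| * (C * 1) + C * F := by
    refine (abs_sub _ _).trans (add_le_add ?_ (abs_observe_le hC hF κ s))
    rw [abs_mul]
    exact mul_le_mul_of_nonneg_left (abs_observe_le hC (fun _ => by simp) κ s) hm0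
  have h5 := integral_rate_nonneg hM.rate_nonneg hs.le hr
  refine (abs_add_le _ _).trans ?_
  rw [abs_mul, abs_of_nonneg h2]
  have h6 := mul_le_mul h3 h4 (abs_nonneg _) (by linarith)
  have h7 : 0 ≤ C * (c + |κ|) * F * ∫ q in s..r, lam q := by positivity
  have h8 : 0 ≤ 4 / 3 * (|mean f| * (C * 1) + C * F) * (r - s) :=
    mul_nonneg (by positivity) (sub_nonneg.2 hr)
  nlinarith [h1, h6, h7, h8]

lemma continuousOn_observe (hM : IsMarkovMotion P c lam v D Z) {ψ : ℝ → ℝ} {C : ℝ}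
    (hC : ∀ x, |ψ x| ≤ C) (hL : ∀ x y, |ψ x - ψ y| ≤ C * |x - y|) (f : Fin 4 → ℝ) (κ : ℝ) :
    ContinuousOn (observe P Z D κ ψ f) (Ioi 0) := by
  obtain ⟨K, hK, h⟩ := hM.exists_abs_observe_sub_le hC hL f κ
  intro t ht
  have hlim : Tendsto (fun r => K * (|r - t| + |∫ q in t..r, lam q|)) (𝓝[Ioi 0] t) (𝓝 0) := by
    have h1 : ContinuousAt (fun r => K * (|r - t| + |∫ q in t..r, lam q|)) t := by
      have := (hasDerivAt_integral_rate hM.rate_cont ht ht).continuousAt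
      fun_prop
    have h2 := h1.tendsto
    simp only [sub_self, abs_zero, intervalIntegral.integral_same, add_zero, mul_zero] at h2
    exact h2.mono_left nhdsWithin_le_nhds
  refine tendsto_iff_dist_tendsto_zero.2 (squeeze_zero' (Eventually.of_forall fun _ => dist_nonneg)
    ?_ hlim)
  filter_upwards [self_mem_nhdsWithin] with r hr
  rw [Real.dist_eq]
  rcases le_total t r with htr | hrt
  · refine (h t r ht htr).trans (mul_le_mul_of_nonneg_left (add_le_add (le_abs_self _)
      (le_abs_self _)) hK)
  · rw [abs_sub_comm, abs_sub_comm r t, intervalIntegral.integral_symm, abs_neg]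
    exact (h r t hr hrt).trans (mul_le_mul_of_nonneg_left (add_le_add (le_abs_self _)
      (le_abs_self _)) hK)

/-- Without an event the path is straight and Taylor's formula leaves an error of order `(r - s) ^
2`. With an event the error is still of order `r - s` by finite speed, and this happens with
probability at most `∫ lam`. -/
lemma exists_abs_expansion_le (hM : IsMarkovMotion P c lam v D Z) {ψ ψ' : ℝ → ℝ} {C : ℝ}
    (hψ : ∀ x, HasDerivAt ψ (ψ' x) x) (hC : ∀ x, |ψ x| ≤ C) (hC' : ∀ x, |ψ' x| ≤ C)
    (hL : ∀ x y, |ψ' x - ψ' y| ≤ C * |x - y|) (f : Fin 4 → ℝ) (κ : ℝ) :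
    ∃ K, 0 ≤ K ∧ ∀ s r, 0 < s → s ≤ r → |observe P Z D κ ψ f r - observe P Z D κ ψ f s -
      (r - s) * observe P Z D κ ψ' (fun k => (c * v k + κ) * f k) s -
      (1 - Real.exp (-(4 / 3 * ∫ q in s..r, lam q))) *
        (mean f * observe P Z D κ ψ (fun _ => 1) s - observe P Z D κ ψ f s)| ≤
      K * ((r - s) + ∫ q in s..r, lam q) * (r - s) := by
  have hψc : Continuous ψ := continuous_iff_continuousAt.2 fun x => (hψ x).continuousAt
  have hC0 : 0 ≤ C := (abs_nonneg _).trans (hC 0)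
  have hψc' : Continuous ψ' :=
    (LipschitzWith.of_dist_le_mul (K := ⟨C, hC0⟩) fun x y => hL x y).continuous
  set F := ∑ k, |f k|
  have hF : ∀ k, |f k| ≤ F := fun k => Finset.single_le_sum (f := fun k => |f k|)
      (fun _ _ => abs_nonneg _) (Finset.mem_univ _)
  have hF0 : 0 ≤ F := (abs_nonneg _).trans (hF 0)
  have hc := hM.speed_nonneg
  have hk0 := abs_nonneg κ
  set B := c + |κ| with hB
  have hB0 : 0 ≤ B := by positivity
  have hvB : ∀ k, |c * v k + κ| ≤ B := fun k => (abs_add_le _ _).trans (by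
    rw [abs_mul, abs_of_nonneg hc]
    linarith [mul_le_of_le_one_right hc (hM.abs_velocity_le k)])
  -- The first summand is the Taylor error on straight paths; the second bounds the increment and
  -- its linear approximation on the exceptional event.
  refine ⟨C * B ^ 2 * F + 2 * (C * B * F), by positivity, fun s r hs hr => ?_⟩
  have hrs := sub_nonneg.2 hr
  have hr0 := hs.trans_le hr
  have i1 := hM.integrable_observe hψc' hC' (fun k => (c * v k + κ) * f k) (q := s) (s := κ * s)
    hs hs
  have i2 := hM.integrable_observe hψc hC f (q := r) (s := κ * r) hr0 hr0
  have i3 := hM.integrable_observe hψc hC f (q := s) (s := κ * s) hs hr0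
  rw [hM.observe_sub hψc hC f κ hs hr]
  obtain ⟨N, hN, hPN, hstr⟩ := hM.straight s r hs hr
  have e1 : ∫ ω, (ψ (Z r ω + κ * r) - ψ (Z s ω + κ * s)) * f (D r ω) ∂P -
      (r - s) * observe P Z D κ ψ' (fun k => (c * v k + κ) * f k) s =
      ∫ ω, ((ψ (Z r ω + κ * r) - ψ (Z s ω + κ * s)) * f (D r ω) -
        (r - s) * (ψ' (Z s ω + κ * s) * ((c * v (D s ω) + κ) * f (D s ω)))) ∂P := by
    rw [observe, ← integral_const_mul, integral_sub]
    · exact (i2.sub i3).congr (ae_of_all _ fun ω => by simp; ring)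
    · exact i1.const_mul _
  have e2 : |∫ ω, (ψ (Z r ω + κ * r) - ψ (Z s ω + κ * s)) * f (D r ω) ∂P -
      (r - s) * observe P Z D κ ψ' (fun k => (c * v k + κ) * f k) s| ≤
      ∫ ω, (C * (B * (r - s)) ^ 2 * F + N.indicator (fun _ => 2 * (C * B * F) * (r - s)) ω) ∂P := by
    rw [e1, ← Real.norm_eq_abs]
    have iN : Integrable (N.indicator fun _ : Ω => 2 * (C * B * F) * (r - s)) P :=
      (integrable_const _).indicator hN
    refine norm_integral_le_of_norm_le ((integrable_const _).add iN) (ae_of_all _ fun ω => ?_)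
    rw [Real.norm_eq_abs]
    by_cases hω : ω ∈ N
    · rw [indicator_of_mem hω]
      have b1 : |(ψ (Z r ω + κ * r) - ψ (Z s ω + κ * s)) * f (D r ω)| ≤ C * (B * (r - s)) * F := by
        rw [abs_mul]
        exact mul_le_mul ((abs_sub_le_of_hasDerivAt hψ hC' _ _).trans
          (mul_le_mul_of_nonneg_left (hM.abs_shift_sub_le κ hs hr ω) hC0)) (hF _) (abs_nonneg _)
          (by positivity)
      have b2 : |(r - s) * (ψ' (Z s ω + κ * s) * ((c * v (D s ω) + κ) * f (D s ω)))| ≤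
          (r - s) * (C * (B * F)) := by
        rw [abs_mul, abs_mul, abs_mul, abs_of_nonneg hrs]
        gcongr
        exacts [hC' _, hvB _, hF _]
      have b3 : 0 ≤ C * (B * (r - s)) ^ 2 * F := by positivity
      refine (abs_sub _ _).trans ?_
      linarith
    · rw [indicator_of_notMem hω]
      obtain ⟨h1, h2⟩ := hstr ω hω
      have h3 : Z r ω + κ * r = Z s ω + κ * s + (c * v (D s ω) + κ) * (r - s) := by rw [h2]; ring
      rw [h1, h3]
      have h4 := abs_taylor_le hψ hL (Z s ω + κ * s) ((c * v (D s ω) + κ) * (r - s))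
      have h5 : (ψ (Z s ω + κ * s + (c * v (D s ω) + κ) * (r - s)) - ψ (Z s ω + κ * s)) *
          f (D s ω) - (r - s) * (ψ' (Z s ω + κ * s) * ((c * v (D s ω) + κ) * f (D s ω))) =
          (ψ (Z s ω + κ * s + (c * v (D s ω) + κ) * (r - s)) - ψ (Z s ω + κ * s) -
            (c * v (D s ω) + κ) * (r - s) * ψ' (Z s ω + κ * s)) * f (D s ω) := by ring
      rw [h5, abs_mul, add_zero]
      refine mul_le_mul (h4.trans ?_) (hF _) (abs_nonneg _) (by positivity)
      refine mul_le_mul_of_nonneg_left (sq_le_sq.2 ?_) hC0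
      rw [abs_mul, abs_mul, abs_of_nonneg hrs, abs_of_nonneg hB0]
      exact mul_le_mul_of_nonneg_right (hvB _) hrs
  have e3 : ∫ ω, (C * (B * (r - s)) ^ 2 * F + N.indicator (fun _ => 2 * (C * B * F) * (r - s)) ω) ∂P
      = C * (B * (r - s)) ^ 2 * F + P.real N * (2 * (C * B * F) * (r - s)) := by
    rw [integral_add (integrable_const _) ((integrable_const _).indicator hN),
      integral_indicator hN]
    simp
  rw [e3] at e2
  have e4 : P.real N * (2 * (C * B * F) * (r - s)) ≤
      (∫ q in s..r, lam q) * (2 * (C * B * F) * (r - s)) :=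
    mul_le_mul_of_nonneg_right hPN (by positivity)
  have e5 : 0 ≤ C * B ^ 2 * F * (∫ q in s..r, lam q) * (r - s) :=
    mul_nonneg (mul_nonneg (by positivity) (integral_rate_nonneg hM.rate_nonneg hs.le hr)) hrs
  have e6 : 0 ≤ 2 * (C * B * F) * (r - s) * (r - s) := by positivity
  have e7 : ∀ a b d : ℝ, a + b - d - b = a - d := fun a b d => by ring
  rw [e7]
  nlinarith [e2, e4, e5, e6]

/-- The Kolmogorov equation of the motion in weak form. -/
lemma hasDerivAt_observe (hM : IsMarkovMotion P c lam v D Z) {ψ ψ' : ℝ → ℝ} {C : ℝ}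
    (hψ : ∀ x, HasDerivAt ψ (ψ' x) x) (hC : ∀ x, |ψ x| ≤ C) (hC' : ∀ x, |ψ' x| ≤ C)
    (hL : ∀ x y, |ψ' x - ψ' y| ≤ C * |x - y|) (f : Fin 4 → ℝ) (κ : ℝ) {t : ℝ} (ht : 0 < t) :
    HasDerivAt (observe P Z D κ ψ f)
      (observe P Z D κ ψ' (fun k => (c * v k + κ) * f k) t +
        4 / 3 * lam t * (mean f * observe P Z D κ ψ (fun _ => 1) t - observe P Z D κ ψ f t)) t := by
  have hLψ := abs_sub_le_of_hasDerivAt hψ hC'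
  have c1 := fun f => hM.continuousOn_observe hC hLψ f κ
  have c2 := hM.continuousOn_observe hC' hL (fun k => (c * v k + κ) * f k) κ
  -- The Markov property looks forward in time and yields right derivatives only; continuity of the
  -- right side gives the two-sided derivative.
  refine hasDerivAt_of_hasDerivWithinAt_right (g := fun t =>
    observe P Z D κ ψ' (fun k => (c * v k + κ) * f k) t +
        4 / 3 * lam t * (mean f * observe P Z D κ ψ (fun _ => 1) t - observe P Z D κ ψ f t))
    (c1 f) ?_ (fun s hs => ?_) ht
  · exact c2.add ((continuousOn_const.mul hM.rate_cont).mul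
      ((continuousOn_const.mul (c1 _)).sub (c1 f)))
  · obtain ⟨K, hK, h⟩ := hM.exists_abs_expansion_le hψ hC hC' hL f κ
    set α := observe P Z D κ ψ' (fun k => (c * v k + κ) * f k) s
    set β := mean f * observe P Z D κ ψ (fun _ => 1) s - observe P Z D κ ψ f s
    have hΛ := hasDerivAt_integral_rate hM.rate_cont hs hs
    have d1 : HasDerivAt (fun r => (r - s) * α + (1 - Real.exp (-(4 / 3 * ∫ q in s..r, lam q))) * β)
        (α + 4 / 3 * lam s * β) s := by
      have := (((hasDerivAt_id s).sub_const s).mul_const α).add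
        ((((hΛ.const_mul (4 / 3)).neg.exp).const_sub 1).mul_const β)
      convert! this using 1
      simp
    have d2 : HasDerivWithinAt (fun r => observe P Z D κ ψ f r - ((r - s) * α +
        (1 - Real.exp (-(4 / 3 * ∫ q in s..r, lam q))) * β)) 0 (Ioi s) s := by
      rw [hasDerivWithinAt_iff_isLittleO, Asymptotics.isLittleO_iff]
      intro ε hε
      have hlim : Tendsto (fun r => K * ((r - s) + ∫ q in s..r, lam q)) (𝓝[>] s) (𝓝 0) := by
        have h1 : ContinuousAt (fun r => K * ((r - s) + ∫ q in s..r, lam q)) s := by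
          have := hΛ.continuousAt
          fun_prop
        have h2 := h1.tendsto
        simp only [sub_self, intervalIntegral.integral_same, add_zero, mul_zero] at h2
        exact h2.mono_left nhdsWithin_le_nhds
      filter_upwards [self_mem_nhdsWithin, hlim.eventually (gt_mem_nhds hε)] with r hr hr2
      have hrs : 0 ≤ r - s := sub_nonneg.2 (le_of_lt hr)
      have h3 := h s r hs (le_of_lt hr)
      rw [Real.norm_eq_abs, Real.norm_eq_abs, abs_of_nonneg hrs]
      refine le_trans (le_of_eq ?_) (h3.trans (mul_le_mul_of_nonneg_right hr2.le hrs))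
      congr 1
      simp
      ring
    have d3 := d2.add d1.hasDerivWithinAt
    simp only [zero_add] at d3
    refine d3.congr (fun x _ => by simp) (by simp)

end IsMarkovMotion

end Kolmogorov

/-! ### The moment system and the weak equation for the whole law. -/

section System

lemma contDiffOn_succ_of_hasDerivAt {F F' : ℝ → ℝ} {n : ℕ}
    (h : ∀ t, 0 < t → HasDerivAt F (F' t) t) (h' : ContDiffOn ℝ n F' (Ioi 0)) :
    ContDiffOn ℝ (n + 1 : ℕ) F (Ioi 0) := by
  push_cast
  rw [contDiffOn_succ_iff_deriv_of_isOpen isOpen_Ioi]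
  refine ⟨fun t ht => (h t ht).differentiableAt.differentiableWithinAt, by simp, ?_⟩
  exact h'.congr fun t ht => (h t ht).deriv

lemma deriv_eventuallyEq_of_hasDerivAt {F F' : ℝ → ℝ} (h : ∀ t, 0 < t → HasDerivAt F (F' t) t)
    {t : ℝ} (ht : 0 < t) : deriv F =ᶠ[𝓝 t] F' := by
  filter_upwards [Ioi_mem_nhds ht] with s hs using (h s hs).deriv

/-- Elimination of the velocity moments `V` and `W` from the first order system. -/
lemma equationAt_of_system {c : ℝ} {lam F G V W S : ℝ → ℝ} (hlam : ContDiffOn ℝ 1 lam (Ioi 0))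
    (hF : ∀ t, 0 < t → HasDerivAt F (c * V t) t)
    (hV : ∀ t, 0 < t → HasDerivAt V (c * W t - 4 / 3 * lam t * V t) t)
    (hW : ∀ t, 0 < t → HasDerivAt W (c * S t + 4 / 3 * lam t * (G t / 2 - W t)) t)
    (hG : ∀ t, 0 < t → HasDerivAt G (c * S t) t) (hS : ContinuousOn S (Ioi 0)) {t : ℝ}
    (ht : 0 < t) :
    ContDiffAt ℝ 3 F t ∧ ContDiffAt ℝ 1 G t ∧ EquationAt c lam F G t := by
  have hlc : ContinuousOn lam (Ioi 0) := hlam.continuousOn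
  have hlam' : ∀ t, 0 < t → HasDerivAt lam (deriv lam t) t := fun t ht =>
    ((hlam.differentiableOn one_ne_zero).differentiableAt (Ioi_mem_nhds ht)).hasDerivAt
  -- Regularity is drawn from the system itself: continuity of `S` makes `G` and `W` of class `C¹`,
  -- then `lam` of class `C¹` makes `V` of class `C²`, hence `F` of class `C³`.
  have cG : ContDiffOn ℝ 1 G (Ioi 0) := contDiffOn_succ_of_hasDerivAt (n := 0) hG
    (contDiffOn_zero.2 (continuousOn_const.mul hS))
  have cW : ContDiffOn ℝ 1 W (Ioi 0) := by
    refine contDiffOn_succ_of_hasDerivAt (n := 0) hW (contDiffOn_zero.2 ?_)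
    have hWc : ContinuousOn W (Ioi 0) := fun t ht => (hW t ht).continuousAt.continuousWithinAt
    have hGc := cG.continuousOn
    fun_prop
  have cV1 : ContDiffOn ℝ 1 V (Ioi 0) := by
    refine contDiffOn_succ_of_hasDerivAt (n := 0) hV (contDiffOn_zero.2 ?_)
    have hVc : ContinuousOn V (Ioi 0) := fun t ht => (hV t ht).continuousAt.continuousWithinAt
    have hWc := cW.continuousOn
    fun_prop
  have cV : ContDiffOn ℝ 2 V (Ioi 0) := contDiffOn_succ_of_hasDerivAt (n := 1) hV
    ((contDiffOn_const.mul cW).sub ((contDiffOn_const.mul hlam).mul cV1))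
  have cF : ContDiffOn ℝ 3 F (Ioi 0) := contDiffOn_succ_of_hasDerivAt (n := 2) hF
    (contDiffOn_const.mul cV)
  refine ⟨cF.contDiffAt (Ioi_mem_nhds ht), cG.contDiffAt (Ioi_mem_nhds ht), ?_⟩
  have h2 : ∀ t, 0 < t → HasDerivAt (deriv F) (c * (c * W t - 4 / 3 * lam t * V t)) t :=
    fun t ht => ((hV t ht).const_mul c).congr_of_eventuallyEq
      (deriv_eventuallyEq_of_hasDerivAt hF ht)
  have h3 := (((((hW t ht).const_mul c).sub (((hlam' t ht).const_mul (4 / 3)).mul (hV t ht))).const_mul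
    c).congr_of_eventuallyEq (deriv_eventuallyEq_of_hasDerivAt h2 ht)).deriv
  rw [EquationAt, iteratedDeriv_succ, iteratedDeriv_succ, iteratedDeriv_one, h3, (h2 t ht).deriv,
    (hF t ht).deriv, (hG t ht).deriv]
  ring

end System

lemma exists_test_bounds {ψ : ℝ → ℝ} (hψ : ContDiff ℝ 2 ψ) (hc : HasCompactSupport ψ) :
    ∃ C, (∀ x, |ψ x| ≤ C) ∧ (∀ x, |deriv ψ x| ≤ C) ∧
      ∀ x y, |deriv ψ x - deriv ψ y| ≤ C * |x - y| := by
  have h1 : ContDiff ℝ 1 (deriv ψ) := (contDiff_succ_iff_deriv.1 hψ).2.2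
  have h2 : Continuous (deriv (deriv ψ)) := h1.continuous_deriv le_rfl
  obtain ⟨C0, hC0⟩ := hc.exists_bound_of_continuous hψ.continuous
  obtain ⟨C1, hC1⟩ := hc.deriv.exists_bound_of_continuous h1.continuous
  obtain ⟨C2, hC2⟩ := hc.deriv.deriv.exists_bound_of_continuous h2
  refine ⟨max C0 (max C1 C2), fun x => (hC0 x).trans (le_max_left _ _), fun x => (hC1 x).trans
    ((le_max_left _ _).trans (le_max_right _ _)), ?_⟩
  exact abs_sub_le_of_hasDerivAt
    (fun x => (h1.differentiable one_ne_zero x).hasDerivAt)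
    (fun x => (hC2 x).trans ((le_max_right _ _).trans (le_max_right _ _)))

section WeakEquation

variable {Ω : Type*} [MeasurableSpace Ω] {P : Measure Ω} {lam : ℝ → ℝ}
  {D : ℝ → Ω → Fin 4} {c : ℝ} {v : Fin 4 → ℝ} {Z : ℝ → Ω → ℝ}

lemma observe_const_mul (κ : ℝ) (ψ : ℝ → ℝ) (a : ℝ) (f : Fin 4 → ℝ) (q : ℝ) :
    observe P Z D κ ψ (fun k => a * f k) q = a * observe P Z D κ ψ f q := by
  rw [observe, observe, ← integral_const_mul]
  congr 1
  funext ω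
  ring

lemma IsMarkovMotion.weak_equation [IsProbabilityMeasure P] (hM : IsMarkovMotion P c lam v D Z)
    (hlam : ContDiffOn ℝ 1 lam (Ioi 0)) (hv1 : ∑ k, v k = 0) (hv2 : ∑ k, v k ^ 2 = 2)
    (hv3 : ∀ k, v k ^ 3 = v k) {ψ : ℝ → ℝ} (hψ : ContDiff ℝ ((⊤ : ℕ∞) : WithTop ℕ∞) ψ)
    (hc : HasCompactSupport ψ) {t : ℝ} (ht : 0 < t) :
    ContDiffAt ℝ 3 (fun s => ∫ ω, ψ (Z s ω) ∂P) t ∧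
    ContDiffAt ℝ 1 (fun s => ∫ ω, iteratedDeriv 2 ψ (Z s ω) ∂P) t ∧
    EquationAt c lam (fun s => ∫ ω, ψ (Z s ω) ∂P)
      (fun s => ∫ ω, iteratedDeriv 2 ψ (Z s ω) ∂P) t := by
  have key : ∀ ψ : ℝ → ℝ, ContDiff ℝ ((⊤ : ℕ∞) : WithTop ℕ∞) ψ → HasCompactSupport ψ →
      ∀ (f : Fin 4 → ℝ) (t : ℝ), 0 < t → HasDerivAt (observe P Z D 0 ψ f)
        (c * observe P Z D 0 (deriv ψ) (fun k => v k * f k) t + 4 / 3 * lam t *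
          (mean f * observe P Z D 0 ψ (fun _ => 1) t - observe P Z D 0 ψ f t)) t := by
    intro ψ hψ hc f t ht
    obtain ⟨C, h0, h1, h2⟩ := exists_test_bounds (contDiff_infty.1 hψ 2) hc
    have := hM.hasDerivAt_observe (fun x => (hψ.differentiable (by simp) x).hasDerivAt)
      h0 h1 h2 f 0 ht
    convert this using 2
    rw [← observe_const_mul]
    congr 1
    funext k
    ring
  have hd : ∀ ψ : ℝ → ℝ, ContDiff ℝ ((⊤ : ℕ∞) : WithTop ℕ∞) ψ →
      ContDiff ℝ ((⊤ : ℕ∞) : WithTop ℕ∞) (deriv ψ) := fun ψ h => (contDiff_infty_iff_deriv.1 h).2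
  have hψ1 := hd _ hψ
  have hψ2 := hd _ hψ1
  have hψ3 := hd _ hψ2
  have hc1 := hc.deriv
  have hc2 := hc1.deriv
  have hc3 := hc2.deriv
  have m1 : mean (fun _ => 1) = 1 := by simp [mean]
  have mv : mean v = 0 := by simp [mean, hv1]
  have mv2 : mean (fun k => v k ^ 2) = 1 / 2 := by simp [mean, hv2]; norm_num
  have e1 : ∀ (ψ : ℝ → ℝ) s, ∫ ω, ψ (Z s ω) ∂P = observe P Z D 0 ψ (fun _ => 1) s := by
    intro ψ s; simp [observe]
  have e2 : iteratedDeriv 2 ψ = deriv (deriv ψ) := by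
    rw [iteratedDeriv_succ, iteratedDeriv_one]
  simp only [e1, e2]
  have hS : ContinuousOn (observe P Z D 0 (deriv (deriv (deriv ψ))) v) (Ioi 0) := by
    intro s hs
    exact (key _ hψ3 hc3 v s hs).continuousAt.continuousWithinAt
  refine equationAt_of_system (V := observe P Z D 0 (deriv ψ) v)
    (W := observe P Z D 0 (deriv (deriv ψ)) fun k => v k ^ 2) hlam ?_ ?_ ?_ ?_ hS ht
  · intro t ht
    convert! key ψ hψ hc (fun _ => 1) t ht using 1
    simp [m1]
  · intro t ht
    convert! key _ hψ1 hc1 v t ht using 1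
    simp only [mv, ← sq]
    ring
  · intro t ht
    convert! key _ hψ2 hc2 (fun k => v k ^ 2) t ht using 1
    -- The identity `v ^ 3 = v` closes the system: the third velocity moment is the function `S`
    -- that also drives `G`.
    have : (fun k => v k * v k ^ 2) = v := by
      funext k
      rw [← pow_succ', hv3]
    rw [mv2, this]
    ring
  · intro t ht
    convert! key _ hψ2 hc2 (fun _ => 1) t ht using 1
    simp [m1]

end WeakEquation

/-! ### Comparison of measures through smooth test functions. -/

section Comparison

open scoped Manifold ContDiff in
lemma exists_smooth_cutoff {K U : Set ℝ} (hK : IsCompact K) (hU : IsOpen U) (hKU : K ⊆ U) :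
    ∃ ψ : ℝ → ℝ, ContDiff ℝ ((⊤ : ℕ∞) : WithTop ℕ∞) ψ ∧ HasCompactSupport ψ ∧
      (∀ x, 0 ≤ ψ x) ∧ (∀ x, ψ x ≤ 1) ∧ (∀ x ∈ K, ψ x = 1) ∧ ∀ x, x ∉ U → ψ x = 0 := by
  -- The intermediate compact set `L` gives the cutoff a compact support inside `U`.
  obtain ⟨L, hL, hKL, hLU⟩ := exists_compact_between hK hU hKU
  obtain ⟨f, hf0, hf1, hf⟩ := exists_contMDiffMap_zero_one_of_isClosed (n := ⊤) 𝓘(ℝ, ℝ)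
    (isOpen_interior (s := L)).isClosed_compl hK.isClosed (disjoint_compl_left_iff_subset.2 hKL)
  have h0 : ∀ x, x ∉ L → f x = 0 := fun x hx => hf0 fun h => hx (interior_subset h)
  exact ⟨f, f.contMDiff.contDiff, HasCompactSupport.intro hL h0, fun x => (hf x).1,
    fun x => (hf x).2, fun x hx => hf1 hx, fun x hx => h0 x fun h => hx (hLU h)⟩

lemma integrable_of_test {ψ : ℝ → ℝ} (hψ : Continuous ψ) (hc : HasCompactSupport ψ) (μ : Measure ℝ)
    [IsLocallyFiniteMeasure μ] : Integrable ψ μ := hψ.integrable_of_hasCompactSupport hc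

/-- Measures on the line are compared by means of smooth test functions. -/
lemma measure_le_of_integral_le {μ ν : Measure ℝ} [IsFiniteMeasure μ] [IsLocallyFiniteMeasure ν]
    (h : ∀ ψ : ℝ → ℝ, ContDiff ℝ ((⊤ : ℕ∞) : WithTop ℕ∞) ψ → HasCompactSupport ψ →
      (∀ x, 0 ≤ ψ x) → ∫ x, ψ x ∂μ ≤ ∫ x, ψ x ∂ν) : μ ≤ ν := by
  refine Measure.le_iff.2 fun A hA => ?_
  -- Inner regularity of `μ` and outer regularity of `ν` reduce the claim to a compact set inside an
  -- open one, between which a cutoff fits.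
  rw [hA.measure_eq_iSup_isCompact_of_ne_top (measure_ne_top μ A)]
  refine iSup₂_le fun K hKA => iSup_le fun hK => le_trans ?_ (measure_mono hKA)
  rw [K.measure_eq_iInf_isOpen ν]
  refine le_iInf₂ fun U hKU => le_iInf fun hU => ?_
  obtain ⟨ψ, hψ, hc, h0, h1, hψK, hψU⟩ := exists_smooth_cutoff hK hU hKU
  have hi := fun (μ : Measure ℝ) [IsLocallyFiniteMeasure μ] =>
    integrable_of_test hψ.continuous hc μ
  calc μ K = ∫⁻ x, K.indicator 1 x ∂μ := by rw [lintegral_indicator_one hK.measurableSet]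
    _ ≤ ∫⁻ x, ENNReal.ofReal (ψ x) ∂μ := lintegral_mono fun x => by
        by_cases hx : x ∈ K
        · simp [hx, hψK x hx]
        · simp [hx]
    _ = ENNReal.ofReal (∫ x, ψ x ∂μ) :=
        (ofReal_integral_eq_lintegral_ofReal (hi μ) (ae_of_all _ h0)).symm
    _ ≤ ENNReal.ofReal (∫ x, ψ x ∂ν) := ENNReal.ofReal_le_ofReal (h ψ hψ hc h0)
    _ = ∫⁻ x, ENNReal.ofReal (ψ x) ∂ν :=
        ofReal_integral_eq_lintegral_ofReal (hi ν) (ae_of_all _ h0)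
    _ ≤ ∫⁻ x, U.indicator 1 x ∂ν := lintegral_mono fun x => by
        by_cases hx : x ∈ U
        · simpa [hx] using h1 x
        · simp [hx, hψU x hx]
    _ = ν U := lintegral_indicator_one hU.measurableSet

end Comparison

/-! ### The motion observed in frames of constant velocity. -/

/-- The indicator function of the directions with velocity `i`. -/
noncomputable def velocityInd (v : Fin 4 → ℝ) (i : ℝ) (k : Fin 4) : ℝ := if v k = i then 1 else 0

/-- The rate, in multiples of `lam`, at which the motion leaves the velocity `i`. -/
noncomputable def leaveRate (v : Fin 4 → ℝ) (i : ℝ) : ℝ := 4 / 3 * (1 - mean (velocityInd v i))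

section Velocity

variable {Ω : Type*} [MeasurableSpace Ω] {P : Measure Ω} {lam : ℝ → ℝ}
  {D : ℝ → Ω → Fin 4} {c : ℝ} {v : Fin 4 → ℝ} {Z : ℝ → Ω → ℝ}

lemma observe_nonneg {ψ : ℝ → ℝ} (h0 : ∀ x, 0 ≤ ψ x) {f : Fin 4 → ℝ}
    (hf : ∀ k, 0 ≤ f k) (κ q : ℝ) : 0 ≤ observe P Z D κ ψ f q :=
  integral_nonneg fun _ => mul_nonneg (h0 _) (hf _)

lemma abs_mean_le {f : Fin 4 → ℝ} {F : ℝ} (hF : ∀ k, |f k| ≤ F) : |mean f| ≤ F := by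
  have := (Finset.abs_sum_le_sum_abs f Finset.univ).trans
    (Finset.sum_le_card_nsmul _ _ F fun k _ => hF k)
  rw [mean, abs_div, abs_of_pos (by norm_num : (0 : ℝ) < 4)]
  simp at this
  linarith

lemma velocityInd_nonneg (v : Fin 4 → ℝ) (i : ℝ) (k : Fin 4) : 0 ≤ velocityInd v i k := by
  unfold velocityInd; split_ifs <;> norm_num

lemma velocityInd_le_one (v : Fin 4 → ℝ) (i : ℝ) (k : Fin 4) : velocityInd v i k ≤ 1 := by
  unfold velocityInd; split_ifs <;> norm_num

lemma mean_velocityInd_nonneg (v : Fin 4 → ℝ) (i : ℝ) : 0 ≤ mean (velocityInd v i) :=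
  div_nonneg (Finset.sum_nonneg fun k _ => velocityInd_nonneg v i k) (by norm_num)

lemma mean_velocityInd_le_one (v : Fin 4 → ℝ) (i : ℝ) : mean (velocityInd v i) ≤ 1 :=
  (le_abs_self _).trans (abs_mean_le fun k => by
    rw [abs_of_nonneg (velocityInd_nonneg v i k)]; exact velocityInd_le_one v i k)

lemma leaveRate_nonneg (v : Fin 4 → ℝ) (i : ℝ) : 0 ≤ leaveRate v i := by
  have := mean_velocityInd_le_one v i
  unfold leaveRate
  linarith

variable [IsProbabilityMeasure P]

namespace IsMarkovMotion

/-- The motion observed along a line of velocity `c * i`, on the event that the current velocity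
is `c * i`. -/
lemma hasDerivAt_observe_velocity (hM : IsMarkovMotion P c lam v D Z) (i : ℝ) {ψ ψ' : ℝ → ℝ} {C : ℝ}
    (hψ : ∀ x, HasDerivAt ψ (ψ' x) x) (hC : ∀ x, |ψ x| ≤ C) (hC' : ∀ x, |ψ' x| ≤ C)
    (hL : ∀ x y, |ψ' x - ψ' y| ≤ C * |x - y|) {q : ℝ} (hq : 0 < q) :
    HasDerivAt (observe P Z D (-(c * i)) ψ (velocityInd v i))
      (lam q * (4 / 3 * mean (velocityInd v i) *
        observe P Z D (-(c * i)) ψ (fun k => 1 - velocityInd v i k) q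
        - leaveRate v i * observe P Z D (-(c * i)) ψ (velocityInd v i) q)) q := by
  have hc : Continuous ψ := continuous_iff_continuousAt.2 fun x => (hψ x).continuousAt
  have h := hM.hasDerivAt_observe hψ hC hC' hL (velocityInd v i) (-(c * i)) hq
  -- Where the indicator is nonzero the velocity equals that of the frame, so the transport term
  -- vanishes.
  have h1 : (fun k => (c * v k + -(c * i)) * velocityInd v i k) = fun _ => 0 := by
    funext k
    unfold velocityInd
    split_ifs with hk
    · rw [hk]; ring
    · ring
  have h2 : observe P Z D (-(c * i)) ψ (fun k => 1 - velocityInd v i k) q =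
      observe P Z D (-(c * i)) ψ (fun _ => 1) q - observe P Z D (-(c * i)) ψ (velocityInd v i) q := by
    simp only [observe]
    rw [← integral_sub (hM.integrable_observe hc hC (fun _ => 1) hq hq)
      (hM.integrable_observe hc hC _ hq hq)]
    congr 1
    funext ω
    ring
  rw [h1] at h
  convert! h using 1
  have h3 : observe P Z D (-(c * i)) ψ' (fun _ => 0) q = 0 := by simp [observe]
  rw [h2, h3, leaveRate]
  ring

/-- With the integrating factor for the loss rate, only the nonnegative gain from other velocities
remains in the derivative. -/
lemma observe_velocity_ge (hM : IsMarkovMotion P c lam v D Z) (i : ℝ) {ψ ψ' : ℝ → ℝ} {C : ℝ}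
    (hψ : ∀ x, HasDerivAt ψ (ψ' x) x) (hC : ∀ x, |ψ x| ≤ C) (hC' : ∀ x, |ψ' x| ≤ C)
    (hL : ∀ x y, |ψ' x - ψ' y| ≤ C * |x - y|) (h0 : ∀ x, 0 ≤ ψ x) {s t : ℝ} (hs : 0 < s)
    (hst : s ≤ t) :
    Real.exp (-(leaveRate v i * ∫ q in s..t, lam q)) *
      observe P Z D (-(c * i)) ψ (velocityInd v i) s ≤
      observe P Z D (-(c * i)) ψ (velocityInd v i) t := by
  set a := leaveRate v i
  have hd : ∀ q, 0 < q → HasDerivAt (fun q => Real.exp (a * ∫ x in s..q, lam x) *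
      observe P Z D (-(c * i)) ψ (velocityInd v i) q) (Real.exp (a * ∫ x in s..q, lam x) *
        (lam q * (4 / 3 * mean (velocityInd v i) *
          observe P Z D (-(c * i)) ψ (fun k => 1 - velocityInd v i k) q))) q := by
    intro q hq
    convert! (((hasDerivAt_integral_rate hM.rate_cont hs hq).const_mul a).exp).mul
      (hM.hasDerivAt_observe_velocity i hψ hC hC' hL hq) using 1
    simp only [a]
    ring
  have hmono := monotoneOn_of_deriv_nonneg (convex_Icc s t)
    (fun q hq => (hd q (hs.trans_le hq.1)).continuousAt.continuousWithinAt)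
    (fun q hq => (hd q (hs.trans_le (interior_subset hq).1)).differentiableAt.differentiableWithinAt)
    (fun q hq => by
      have hq0 := hs.trans_le (interior_subset hq).1
      rw [(hd q hq0).deriv]
      exact mul_nonneg (Real.exp_pos _).le (mul_nonneg (hM.rate_nonneg q hq0)
        (mul_nonneg (mul_nonneg (by norm_num) (mean_velocityInd_nonneg v i))
          (observe_nonneg h0 (fun k => sub_nonneg.2 (velocityInd_le_one v i k)) _ _))))
    (left_mem_Icc.2 hst) (right_mem_Icc.2 hst) hst
  simp only [intervalIntegral.integral_same, mul_zero, Real.exp_zero, one_mul] at hmono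
  calc _ ≤ Real.exp (-(a * ∫ q in s..t, lam q)) * (Real.exp (a * ∫ x in s..t, lam x) *
      observe P Z D (-(c * i)) ψ (velocityInd v i) t) :=
        mul_le_mul_of_nonneg_left hmono (Real.exp_pos _).le
    _ = _ := by rw [← mul_assoc, ← Real.exp_add, neg_add_cancel, Real.exp_zero, one_mul]

/-- Up to a multiple of Lebesgue measure, only the paths of constant velocity contribute to the
law of the motion. -/
lemma exists_observe_velocity_le (hM : IsMarkovMotion P c lam v D Z) (hc : 0 < c) {i : ℝ}
    (hi : ∀ k, v k ≠ i → 1 ≤ |v k - i|) {s t : ℝ} (hs : 0 < s) (hst : s ≤ t) :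
    ∃ K, 0 ≤ K ∧ ∀ (ψ ψ' : ℝ → ℝ) (C : ℝ), (∀ x, HasDerivAt ψ (ψ' x) x) → (∀ x, |ψ x| ≤ C) →
      (∀ x, |ψ' x| ≤ C) → (∀ x y, |ψ' x - ψ' y| ≤ C * |x - y|) → (∀ x, 0 ≤ ψ x) → Integrable ψ →
      observe P Z D (-(c * i)) ψ (velocityInd v i) t ≤
        Real.exp (-(leaveRate v i * ∫ q in s..t, lam q)) *
          observe P Z D (-(c * i)) ψ (velocityInd v i) s + K * ∫ x, ψ x := by
  obtain ⟨L, hL⟩ := isCompact_Icc.exists_bound_of_continuousOn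
    (hM.rate_cont.mono fun x (hx : x ∈ Icc s t) => hs.trans_le hx.1)
  have hL0 : 0 ≤ L := (norm_nonneg _).trans (hL s (left_mem_Icc.2 hst))
  have hlamL : ∀ q ∈ Icc s t, lam q ≤ L := fun q hq => (le_abs_self _).trans (hL q hq)
  set a := leaveRate v i
  -- This weight cancels the relative speed: differentiating an observable built on the
  -- antiderivative `Ψ` of `ψ` then returns exactly the mass `R` of the other velocities, up to a
  -- switching term bounded by `∫ ψ`.
  set g : Fin 4 → ℝ := fun k => if v k = i then 0 else 1 / (c * (v k - i)) with hg
  have hgc : ∀ k, |g k| ≤ 1 / c := by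
    intro k
    simp only [hg]
    split_ifs with h
    · simpa using hc.le
    · rw [abs_div, abs_one, abs_mul, abs_of_pos hc]
      exact one_div_le_one_div_of_le hc (le_mul_of_one_le_right hc.le (hi k h))
  have hgi : (fun k => (c * v k + -(c * i)) * g k) = fun k => 1 - velocityInd v i k := by
    funext k
    simp only [hg, velocityInd]
    split_ifs with h
    · simp
    · have : v k - i ≠ 0 := sub_ne_zero.2 h
      field_simp
      ring
  -- The first term bounds the total variation of `4 / 3 * L * S` between the endpoints, the second
  -- the accumulated switching error, at rate `M` per unit of time.
  refine ⟨4 / 3 * L * (2 / c) + 4 / 3 * L * (4 / 3 * L * (2 / c)) * (t - s),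
    add_nonneg (by positivity) (mul_nonneg (by positivity) (sub_nonneg.2 hst)), ?_⟩
  intro ψ ψ' C hψ hC hC' hLψ h0 hint
  set I := ∫ x, ψ x with hI
  have hI0 : 0 ≤ I := integral_nonneg h0
  have hψc : Continuous ψ := continuous_iff_continuousAt.2 fun x => (hψ x).continuousAt
  set Ψ : ℝ → ℝ := fun x => ∫ y in 0..x, ψ y
  have hΨ : ∀ x, HasDerivAt Ψ (ψ x) x := fun x =>
    intervalIntegral.integral_hasDerivAt_right (hψc.intervalIntegrable _ _)
      (hψc.stronglyMeasurableAtFilter _ _) hψc.continuousAt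
  have hΨI : ∀ x, |Ψ x| ≤ I := by
    intro x
    calc ‖Ψ x‖ ≤ ∫ y in uIoc 0 x, ‖ψ y‖ := intervalIntegral.norm_integral_le_integral_norm_uIoc
      _ ≤ ∫ y, ‖ψ y‖ := setIntegral_le_integral hint.norm (ae_of_all _ fun _ => norm_nonneg _)
      _ = I := by simp [hI, abs_of_nonneg (h0 _)]
  set S := observe P Z D (-(c * i)) Ψ g with hS
  set R := observe P Z D (-(c * i)) ψ (fun k => 1 - velocityInd v i k) with hR
  set w := observe P Z D (-(c * i)) ψ (velocityInd v i) with hw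
  have hSI : ∀ q, |S q| ≤ I * (1 / c) := fun q => abs_observe_le hΨI hgc _ q
  have hS1 : ∀ q, |mean g * observe P Z D (-(c * i)) Ψ (fun _ => 1) q - S q| ≤ 2 / c * I := by
    intro q
    refine (abs_sub _ _).trans ?_
    have h1 : |observe P Z D (-(c * i)) Ψ (fun _ => 1) q| ≤ I * 1 :=
      abs_observe_le hΨI (fun _ => by simp) _ q
    have h2 := mul_le_mul (abs_mean_le hgc) h1 (abs_nonneg _) (by positivity)
    rw [abs_mul]
    calc _ ≤ 1 / c * (I * 1) + I * (1 / c) := add_le_add h2 (hSI q)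
      _ = 2 / c * I := by ring
  have hdS : ∀ q, 0 < q → HasDerivAt S (R q + 4 / 3 * lam q *
      (mean g * observe P Z D (-(c * i)) Ψ (fun _ => 1) q - S q)) q := by
    intro q hq
    have := hM.hasDerivAt_observe (ψ := Ψ) (ψ' := ψ) (C := max I C) hΨ
      (fun x => (hΨI x).trans (le_max_left _ _)) (fun x => (hC x).trans (le_max_right _ _))
      (fun x y => (abs_sub_le_of_hasDerivAt hψ hC' x y).trans
        (mul_le_mul_of_nonneg_right (le_max_right _ _) (abs_nonneg _))) g (-(c * i)) hq
    rwa [hgi] at this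
  have hdw := fun q (hq : 0 < q) => hM.hasDerivAt_observe_velocity i hψ hC hC' hLψ hq
  set M := 4 / 3 * L * (4 / 3 * L * (2 / c * I)) with hMdef
  -- The integrating factor is normalised at the final time, so that `B t = 1` and `B ≤ 1` before.
  set B : ℝ → ℝ := fun q => Real.exp (a * ((∫ x in s..q, lam x) - ∫ x in s..t, lam x)) with hB
  -- Subtracting `4 / 3 * L * S` compensates the gain term, and subtracting `M * q` the switching
  -- error of `S`; the resulting function decreases on `[s, t]`.
  have hdH : ∀ q, 0 < q → HasDerivAt (fun q => B q * w q - 4 / 3 * L * S q - M * q)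
      (B q * (lam q * (4 / 3 * mean (velocityInd v i) * R q)) - 4 / 3 * L * (R q + 4 / 3 * lam q *
      (mean g * observe P Z D (-(c * i)) Ψ (fun _ => 1) q - S q)) - M) q := by
    intro q hq
    convert! (((((((hasDerivAt_integral_rate hM.rate_cont hs hq).sub_const
      (∫ x in s..t, lam x)).const_mul a).exp).mul (hdw q hq)).sub
        ((hdS q hq).const_mul (4 / 3 * L))).sub ((hasDerivAt_id q).const_mul M)) using 1
    simp only [a, hB, hR]
    ring
  have hanti := antitoneOn_of_deriv_nonpos (convex_Icc s t)
    (fun q hq => (hdH q (hs.trans_le hq.1)).continuousAt.continuousWithinAt)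
    (fun q hq => (hdH q (hs.trans_le (interior_subset hq).1)).differentiableAt.differentiableWithinAt)
    (fun q hq => by
      have hq' := interior_subset hq
      have hq0 := hs.trans_le hq'.1
      rw [(hdH q hq0).deriv]
      have hR0 : 0 ≤ R q :=
        observe_nonneg h0 (fun k => sub_nonneg.2 (velocityInd_le_one v i k)) _ _
      have hlam0 := hM.rate_nonneg q hq0
      have hB1 : B q ≤ 1 := by
        refine Real.exp_le_one_iff.2 (mul_nonpos_of_nonneg_of_nonpos (leaveRate_nonneg v i) ?_)
        have h1 := intervalIntegral.integral_add_adjacent_intervals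
          (intervalIntegrable_rate hM.rate_cont hs hq0)
          (intervalIntegrable_rate hM.rate_cont hq0 (hs.trans_le hst))
        have h2 := integral_rate_nonneg hM.rate_nonneg hq0.le hq'.2
        linarith
      have h1 : B q * (lam q * (4 / 3 * mean (velocityInd v i) * R q)) ≤
          1 * (L * (4 / 3 * 1 * R q)) := by
        have hm0 := mean_velocityInd_nonneg v i
        gcongr
        · exact hlamL q hq'
        · exact mean_velocityInd_le_one v i
      have h2 : -(mean g * observe P Z D (-(c * i)) Ψ (fun _ => 1) q - S q) ≤ 2 / c * I :=
        (neg_le_abs _).trans (hS1 q)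
      have h3 : 4 / 3 * lam q * -(mean g * observe P Z D (-(c * i)) Ψ (fun _ => 1) q - S q) ≤
          4 / 3 * L * (2 / c * I) := by
        refine (mul_le_mul_of_nonneg_left h2 (by positivity)).trans ?_
        have := hlamL q hq'
        gcongr
      have h4 := mul_le_mul_of_nonneg_left h3 (by positivity : 0 ≤ 4 / 3 * L)
      rw [hMdef]
      linarith)
    (left_mem_Icc.2 hst) (right_mem_Icc.2 hst) hst
  have hBt : B t = 1 := by simp [hB]
  have hBs : B s = Real.exp (-(a * ∫ q in s..t, lam q)) := by simp [hB]
  simp only [hBt, hBs, one_mul] at hanti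
  have h1 := (le_abs_self _).trans (hSI t)
  have h2 := (neg_le_abs _).trans (hSI s)
  have h3 : 4 / 3 * L * (S t - S s) ≤ 4 / 3 * L * (2 / c * I) := by
    refine mul_le_mul_of_nonneg_left ?_ (by positivity)
    calc S t - S s ≤ I * (1 / c) + I * (1 / c) := by linarith
      _ = 2 / c * I := by ring
  rw [hMdef] at hanti
  linarith

end IsMarkovMotion

end Velocity

/-! ### Transport of the singular part of the law. -/

section Singular

variable {Ω : Type*} [MeasurableSpace Ω] {P : Measure Ω} {lam : ℝ → ℝ}
  {D : ℝ → Ω → Fin 4} {c : ℝ} {v : Fin 4 → ℝ} {Z : ℝ → Ω → ℝ}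

namespace IsMarkovMotion

lemma measurableSet_velocity_eq (hM : IsMarkovMotion P c lam v D Z) (i : ℝ) {t : ℝ} (ht : 0 < t) :
    MeasurableSet {ω | v (D t ω) = i} :=
  hM.measurable_direction t ht (MeasurableSet.of_discrete (s := {k | v k = i}))

lemma integral_map_restrict (hM : IsMarkovMotion P c lam v D Z) (i : ℝ) {ψ : ℝ → ℝ}
    (hψ : Continuous ψ) {q : ℝ} (hq : 0 < q) (t : ℝ) :
    ∫ x, ψ x ∂((P.restrict {ω | v (D q ω) = i}).map fun ω => Z q ω + c * i * (t - q)) =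
      observe P Z D (-(c * i)) (fun x => ψ (x + c * i * t)) (velocityInd v i) q := by
  rw [integral_map ((hM.measurable_position q hq).add_const _).aemeasurable
    hψ.aestronglyMeasurable, ← integral_indicator (hM.measurableSet_velocity_eq i hq), observe]
  congr 1
  funext ω
  rw [show Z q ω + -(c * i) * q + c * i * t = Z q ω + c * i * (t - q) by ring, velocityInd]
  by_cases h : v (D q ω) = i <;> simp [h]

variable [IsProbabilityMeasure P]

/-- The singular part of the law of the motion is transported by the paths of constant velocity. -/
lemma real_velocity_mem_null (hM : IsMarkovMotion P c lam v D Z) (hc : 0 < c) {i : ℝ}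
    (hi : ∀ k, v k ≠ i → 1 ≤ |v k - i|) {A : Set ℝ} (hA : MeasurableSet A) (hA0 : volume A = 0)
    {s t : ℝ} (hs : 0 < s) (hst : s ≤ t) :
    P.real {ω | v (D t ω) = i ∧ Z t ω ∈ A} =
      Real.exp (-(leaveRate v i * ∫ q in s..t, lam q)) *
        P.real {ω | v (D s ω) = i ∧ Z s ω + c * i * (t - s) ∈ A} := by
  have ht := hs.trans_le hst
  set e := Real.exp (-(leaveRate v i * ∫ q in s..t, lam q)) with he
  have he0 : 0 ≤ e := (Real.exp_pos _).le
  -- The mass with velocity `c * i` at time `q` is moved to where it would be at time `t` without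
  -- further switches.
  set μ := fun q => (P.restrict {ω | v (D q ω) = i}).map fun ω => Z q ω + c * i * (t - q) with hμ
  have hfin : ∀ q, IsFiniteMeasure (μ q) := fun q => by simp only [hμ]; infer_instance
  have happ : ∀ q, 0 < q → (μ q).real A =
      P.real {ω | v (D q ω) = i ∧ Z q ω + c * i * (t - q) ∈ A} := by
    intro q hq
    have hm : Measurable fun ω => Z q ω + c * i * (t - q) :=
      (hM.measurable_position q hq).add_const _
    simp only [hμ]
    rw [map_measureReal_apply hm hA, measureReal_restrict_apply (hm hA)]
    congr 1
    ext ω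
    simp [and_comm]
  obtain ⟨K, hK, hup⟩ := hM.exists_observe_velocity_le hc hi hs hst
  have hbounds : ∀ ψ : ℝ → ℝ, ContDiff ℝ ((⊤ : ℕ∞) : WithTop ℕ∞) ψ → HasCompactSupport ψ →
      (∀ x, 0 ≤ ψ x) → e * ∫ x, ψ x ∂(μ s) ≤ ∫ x, ψ x ∂(μ t) ∧
        ∫ x, ψ x ∂(μ t) ≤ e * ∫ x, ψ x ∂(μ s) + K * ∫ x, ψ x := by
    intro ψ hψ hcs h0
    obtain ⟨C, hC, hC', hL⟩ := exists_test_bounds (contDiff_infty.1 hψ 2) hcs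
    have hd : ∀ x, HasDerivAt (fun x => ψ (x + c * i * t)) (deriv ψ (x + c * i * t)) x := fun x =>
      ((hψ.differentiable (by simp) (x + c * i * t)).hasDerivAt).comp_add_const x (c * i * t)
    have hL' : ∀ x y, |deriv ψ (x + c * i * t) - deriv ψ (y + c * i * t)| ≤ C * |x - y| :=
      fun x y => by simpa using hL (x + c * i * t) (y + c * i * t)
    have hint := hψ.continuous.integrable_of_hasCompactSupport hcs (μ := volume)
    simp only [hμ]
    rw [hM.integral_map_restrict i hψ.continuous hs t, hM.integral_map_restrict i hψ.continuous ht t]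
    refine ⟨hM.observe_velocity_ge i hd (fun x => hC _) (fun x => hC' _) hL' (fun x => h0 _) hs hst,
      ?_⟩
    have := hup _ _ C hd (fun x => hC _) (fun x => hC' _) hL' (fun x => h0 _)
      (hint.comp_add_right _)
    rwa [integral_add_right_eq_self ψ] at this
  have h1 : e.toNNReal • μ s ≤ μ t := by
    refine measure_le_of_integral_le fun ψ hψ hcs h0 => ?_
    rw [integral_smul_nnreal_measure, NNReal.smul_def, Real.coe_toNNReal e he0]
    exact (hbounds ψ hψ hcs h0).1
  have h2 : μ t ≤ e.toNNReal • μ s + K.toNNReal • volume := by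
    have : IsLocallyFiniteMeasure (e.toNNReal • μ s + K.toNNReal • volume) := by
      refine ⟨fun x => ?_⟩
      obtain ⟨U, hU, hU'⟩ := (K.toNNReal • (volume : Measure ℝ)).finiteAt_nhds x
      exact ⟨U, hU, by simpa using ⟨measure_lt_top (e.toNNReal • μ s) U, hU'⟩⟩
    refine measure_le_of_integral_le fun ψ hψ hcs h0 => ?_
    rw [integral_add_measure (integrable_of_test hψ.continuous hcs _)
      (integrable_of_test hψ.continuous hcs _), integral_smul_nnreal_measure,
      integral_smul_nnreal_measure, NNReal.smul_def, NNReal.smul_def, Real.coe_toNNReal e he0,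
      Real.coe_toNNReal K hK]
    exact (hbounds ψ hψ hcs h0).2
  -- The two bounds on `μ t` differ by a multiple of Lebesgue measure, which does not charge `A`.
  have h3 : μ t A = ENNReal.ofReal e * μ s A := by
    refine le_antisymm ?_ (h1 A)
    have := h2 A
    rw [Measure.add_apply, Measure.smul_apply, Measure.smul_apply, hA0, smul_zero, add_zero] at this
    exact this
  have h4 : (μ t).real A = e * (μ s).real A := by
    rw [measureReal_def, h3, ENNReal.toReal_mul, ENNReal.toReal_ofReal he0, measureReal_def]
  rw [happ t ht, happ s hs] at h4
  simpa using h4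

end IsMarkovMotion

/-- If the rate is not integrable near `0`, the law of the motion has no singular part. -/
lemma IsMarkovMotion.real_velocity_mem_eq_zero [IsProbabilityMeasure P]
    (hM : IsMarkovMotion P c lam v D Z) (hc : 0 < c)
    {i : ℝ} (hi : ∀ k, v k ≠ i → 1 ≤ |v k - i|) (ha : 0 < leaveRate v i) {A : Set ℝ}
    (hA : MeasurableSet A) (hA0 : volume A = 0) {t : ℝ} (ht : 0 < t)
    (hlam : ¬ IntegrableOn lam (Ioc 0 t)) : P.real {ω | v (D t ω) = i ∧ Z t ω ∈ A} = 0 := by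
  by_contra hne
  set p := P.real {ω | v (D t ω) = i ∧ Z t ω ∈ A}
  have hp : 0 < p := lt_of_le_of_ne measureReal_nonneg (Ne.symm hne)
  -- A positive probability `p` is at most the survival factor from every earlier time, which bounds
  -- the integrals of the rate up to `0` and contradicts their divergence.
  have hbd : ∀ s, 0 < s → s ≤ t → ∫ q in s..t, lam q ≤ -Real.log p / leaveRate v i := by
    intro s hs hst
    have h1 := hM.real_velocity_mem_null hc hi hA hA0 hs hst
    have h2 : p ≤ Real.exp (-(leaveRate v i * ∫ q in s..t, lam q)) := by
      rw [show p = _ from h1]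
      exact mul_le_of_le_one_right (Real.exp_pos _).le measureReal_le_one
    have h3 := (Real.log_le_iff_le_exp hp).2 h2
    rw [le_div_iff₀ ha]
    linarith
  apply hlam
  have hlim : Tendsto (fun n : ℕ => t / (n + 1)) atTop (𝓝 0) := by
    simpa [div_eq_mul_inv] using
      (tendsto_one_div_add_atTop_nhds_zero_nat (𝕜 := ℝ)).const_mul t
  refine integrableOn_Ioc_of_intervalIntegral_norm_bounded_left
    (a := fun n : ℕ => t / (n + 1)) (I := -Real.log p / leaveRate v i) (l := atTop)
    (fun n => integrableOn_rate hM.rate_cont (by positivity)) hlim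
    (Eventually.of_forall fun n => ?_)
  have hn : 0 < t / (n + 1) := by positivity
  have hnt : t / (n + 1) ≤ t := div_le_self ht.le (by simp)
  rw [← intervalIntegral.integral_of_le hnt]
  refine le_trans (le_of_eq ?_) (hbd _ hn hnt)
  refine intervalIntegral.integral_congr fun q hq => ?_
  rw [uIcc_of_le hnt] at hq
  exact Real.norm_of_nonneg (hM.rate_nonneg q (hn.trans_le hq.1))

end Singular

/-! ### The velocities of the two coordinates and their leave rates. -/

/-- The properties shared by the two coordinates of the four directions. -/
structure IsCoordinate (v : Fin 4 → ℝ) : Prop where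
  cases : ∀ k, v k = 1 ∨ v k = -1 ∨ v k = 0
  sum_eq : ∑ k, v k = 0
  sum_sq : ∑ k, v k ^ 2 = 2
  mean_one : mean (velocityInd v 1) = 1 / 4
  mean_neg_one : mean (velocityInd v (-1)) = 1 / 4
  mean_zero : mean (velocityInd v 0) = 1 / 2

lemma isCoordinate_dirX : IsCoordinate dirX where
  cases k := by fin_cases k <;> simp [dirX]
  sum_eq := by simp [dirX, Fin.sum_univ_four]
  sum_sq := by simp [dirX, Fin.sum_univ_four]; norm_num
  mean_one := by simp [mean, velocityInd, dirX, Fin.sum_univ_four]; norm_num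
  mean_neg_one := by simp [mean, velocityInd, dirX, Fin.sum_univ_four]; norm_num
  mean_zero := by simp [mean, velocityInd, dirX, Fin.sum_univ_four]; norm_num

lemma isCoordinate_dirY : IsCoordinate dirY where
  cases k := by fin_cases k <;> simp [dirY]
  sum_eq := by simp [dirY, Fin.sum_univ_four]
  sum_sq := by simp [dirY, Fin.sum_univ_four]; norm_num
  mean_one := by simp [mean, velocityInd, dirY, Fin.sum_univ_four]; norm_num
  mean_neg_one := by simp [mean, velocityInd, dirY, Fin.sum_univ_four]; norm_num
  mean_zero := by simp [mean, velocityInd, dirY, Fin.sum_univ_four]; norm_num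

namespace IsCoordinate

variable {v : Fin 4 → ℝ}

lemma abs_le_one (hv : IsCoordinate v) (k : Fin 4) : |v k| ≤ 1 := by
  rcases hv.cases k with h | h | h <;> simp [h]

lemma cube (hv : IsCoordinate v) (k : Fin 4) : v k ^ 3 = v k := by
  rcases hv.cases k with h | h | h <;> rw [h] <;> norm_num

lemma one_le_abs_sub (hv : IsCoordinate v) {i : ℝ} (hi : i = 1 ∨ i = -1 ∨ i = 0) (k : Fin 4)
    (hk : v k ≠ i) : 1 ≤ |v k - i| := by
  rcases hv.cases k with h | h | h <;> rcases hi with rfl | rfl | rfl <;> rw [h] at hk ⊢ <;>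
    first | exact absurd rfl hk | norm_num

lemma leaveRate_one (hv : IsCoordinate v) : leaveRate v 1 = 1 := by
  rw [leaveRate, hv.mean_one]; norm_num

lemma leaveRate_neg_one (hv : IsCoordinate v) : leaveRate v (-1) = 1 := by
  rw [leaveRate, hv.mean_neg_one]; norm_num

lemma leaveRate_zero (hv : IsCoordinate v) : leaveRate v 0 = 2 / 3 := by
  rw [leaveRate, hv.mean_zero]; norm_num

end IsCoordinate

/-! ### The atoms, and absolute continuity off them. -/

section Law

variable {Ω : Type*} [MeasurableSpace Ω] {P : Measure Ω} [IsProbabilityMeasure P] {lam : ℝ → ℝ}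
  {T : Ω → Set ℝ} {D : ℝ → Ω → Fin 4} {c : ℝ} {v : Fin 4 → ℝ}

lemma IsSwitchingChain.real_start {E : ℕ → Ω → Fin 4} (hE : IsSwitchingChain P E) (i : ℝ) :
    P.real {ω | v (E 0 ω) = i} = mean (velocityInd v i) := by
  have h1 : ∀ k, P.real (E 0 ⁻¹' {k}) = 1 / 4 := by
    intro k
    have h := hE.law 0 (fun _ => k) (by simp)
    have h' : {ω | ∀ j ≤ 0, E j ω = k} = E 0 ⁻¹' {k} := by ext ω; simp
    rw [h'] at h
    rw [measureReal_def, h]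
    simp
  have hS : MeasurableSet {ω | v (E 0 ω) = i} :=
    hE.measurable 0 (MeasurableSet.of_discrete (s := {k | v k = i}))
  have h2 : P.real {ω | v (E 0 ω) = i} = ∫ ω, velocityInd v i (E 0 ω) ∂P := by
    rw [← integral_indicator_one hS]
    congr 1
  have := Measure.isProbabilityMeasure_map (μ := P) (hE.measurable 0).aemeasurable
  rw [h2, ← integral_map (hE.measurable 0).aemeasurable
    (by exact Measurable.of_discrete.aestronglyMeasurable), integral_fintype Integrable.of_finite,
    mean, Finset.sum_div]
  refine Finset.sum_congr rfl fun k _ => ?_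
  rw [map_measureReal_apply (hE.measurable 0) (measurableSet_singleton k), h1, smul_eq_mul]
  ring

open Classical in
/-- The singular part of the law of the motion when the rate is integrable near `0`. -/
lemma IsReflectingDirection.real_velocity_mem_null (hD : IsReflectingDirection P lam T D)
    (hlam : ContinuousOn lam (Ioi 0)) (hpos : ∀ t, 0 < t → 0 ≤ lam t) (hc : 0 < c)
    (hv : ∀ k, |v k| ≤ 1) {i : ℝ} (hi : ∀ k, v k ≠ i → 1 ≤ |v k - i|) {A : Set ℝ}
    (hA : MeasurableSet A) (hA0 : volume A = 0) {t : ℝ} (ht : 0 < t)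
    (hint : IntegrableOn lam (Ioc 0 t)) :
    P.real {ω | v (D t ω) = i ∧ pos c v D t ω ∈ A} =
      Real.exp (-(leaveRate v i * ∫ q in 0..t, lam q)) *
        (if c * i * t ∈ A then mean (velocityInd v i) else 0) := by
  have hM := hD.isMarkovMotion hlam hpos hc.le hv
  have hint' := integrableOn_rate_zero hlam ht hint
  have hsw := hD.start_zero fun b _ => hint' b
  have hdir : ∀ {s : ℝ} {ω : Ω}, 0 ≤ s → count T 0 s ω = 0 → D s ω = D 0 ω := fun hs h0 =>
    hD.poisson.direction_eq le_rfl hint' hsw le_rfl hs h0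
  set m := if c * i * t ∈ A then mean (velocityInd v i) else 0 with hm
  have hstart : P.real {ω | v (D 0 ω) = i ∧ c * i * t ∈ A} = m := by
    obtain ⟨E, hE, -, hDE⟩ := hsw
    simp only [hDE 0 le_rfl, count_self, hm]
    split_ifs with h
    · simp only [h, and_true]
      exact hE.real_start i
    · simp [h]
  have hiv : ∀ b, 0 ≤ b → IntervalIntegrable lam volume 0 b := fun b hb =>
    (intervalIntegrable_iff_integrableOn_Ioc_of_le hb).2 (hint' b)
  -- Outside an event of probability at most `∫ q in 0..s, lam q` no switch occurs before `s`, and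
  -- the transported position is then `c * i * t` if the initial velocity is `c * i`.
  have hclose : ∀ s, 0 < s → s ≤ t →
      |P.real {ω | v (D s ω) = i ∧ pos c v D s ω + c * i * (t - s) ∈ A} - m| ≤
        ∫ q in 0..s, lam q := by
    intro s hs hst
    set N := {ω | count T 0 s ω ≠ 0} with hN
    have hPN : P.real N ≤ ∫ q in 0..s, lam q := hD.poisson.real_count_ne_zero_le le_rfl hs.le
      (hint' s) (integral_rate_nonneg hpos le_rfl hs.le)
    have hiff : ∀ ω, ω ∉ N → ((v (D s ω) = i ∧ pos c v D s ω + c * i * (t - s) ∈ A) ↔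
        (v (D 0 ω) = i ∧ c * i * t ∈ A)) := by
      intro ω hω
      have h0 : count T 0 s ω = 0 := not_not.1 hω
      have h1 : pos c v D s ω = c * v (D 0 ω) * s := by
        have : pos c v D s ω = ∫ q in 0..s, c * v (D 0 ω) := by
          refine intervalIntegral.integral_congr fun q hq => ?_
          rw [uIcc_of_le hs.le] at hq
          rw [hdir hq.1 (hD.poisson.count_eq_zero_of_le le_rfl (hint' s) hq.2 h0)]
        rw [this, intervalIntegral.integral_const, smul_eq_mul]
        ring
      rw [hdir hs.le h0, h1]
      refine and_congr_right fun h => ?_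
      rw [h, show c * i * s + c * i * (t - s) = c * i * t by ring]
    rw [← hstart]
    have h1 : P.real {ω | v (D s ω) = i ∧ pos c v D s ω + c * i * (t - s) ∈ A} ≤
        P.real {ω | v (D 0 ω) = i ∧ c * i * t ∈ A} + P.real N :=
      (measureReal_mono fun ω hω => or_iff_not_imp_right.2 fun h => (hiff ω h).1 hω).trans
        (measureReal_union_le _ _)
    have h2 : P.real {ω | v (D 0 ω) = i ∧ c * i * t ∈ A} ≤
        P.real {ω | v (D s ω) = i ∧ pos c v D s ω + c * i * (t - s) ∈ A} + P.real N :=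
      (measureReal_mono fun ω hω => or_iff_not_imp_right.2 fun h => (hiff ω h).2 hω).trans
        (measureReal_union_le _ _)
    rw [abs_le]
    constructor <;> linarith
  have hprim : Tendsto (fun s => ∫ q in 0..s, lam q) (𝓝[>] 0) (𝓝 0) := by
    have h := intervalIntegral.continuousOn_primitive_interval (μ := volume) (f := lam) (a := 0)
      (b := t) (by rw [uIcc_of_le ht.le, integrableOn_Icc_iff_integrableOn_Ioc]; exact hint)
    have h0 := (h 0 left_mem_uIcc).tendsto
    rw [intervalIntegral.integral_same, uIcc_of_le ht.le] at h0
    refine h0.mono_left ?_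
    rw [← nhdsWithin_Ioc_eq_nhdsGT ht]
    exact nhdsWithin_mono _ Ioc_subset_Icc_self
  have hev : ∀ᶠ s in 𝓝[>] (0 : ℝ), 0 < s ∧ s ≤ t := by
    filter_upwards [Ioc_mem_nhdsGT ht] with s hs using hs
  have hlim1 : Tendsto (fun s => P.real {ω | v (D s ω) = i ∧ pos c v D s ω + c * i * (t - s) ∈ A})
      (𝓝[>] 0) (𝓝 m) := by
    refine tendsto_iff_dist_tendsto_zero.2 (squeeze_zero' (Eventually.of_forall fun _ => dist_nonneg)
      ?_ hprim)
    filter_upwards [hev] with s hs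
    exact hclose s hs.1 hs.2
  have hlim2 : Tendsto (fun s => Real.exp (-(leaveRate v i * ∫ q in s..t, lam q))) (𝓝[>] 0)
      (𝓝 (Real.exp (-(leaveRate v i * ∫ q in 0..t, lam q)))) := by
    have h : Tendsto (fun s => Real.exp (-(leaveRate v i *
        ((∫ q in 0..t, lam q) - ∫ q in 0..s, lam q)))) (𝓝[>] 0)
        (𝓝 (Real.exp (-(leaveRate v i * ((∫ q in 0..t, lam q) - 0))))) :=
      (Real.continuous_exp.tendsto _).comp ((hprim.const_sub _).const_mul _).neg
    rw [sub_zero] at h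
    refine h.congr' ?_
    filter_upwards [hev] with s hs
    rw [intervalIntegral.integral_interval_sub_left (hiv t ht.le) (hiv s hs.1.le)]
  -- The transport identity has a left side independent of `s`, so it passes to the limit `s → 0`.
  refine tendsto_nhds_unique (tendsto_const_nhds.congr' ?_) (hlim2.mul hlim1)
  filter_upwards [hev] with s hs
  exact hM.real_velocity_mem_null hc hi hA hA0 hs.1 hs.2

lemma IsMarkovMotion.real_mem_eq_add {Z : ℝ → Ω → ℝ} (hM : IsMarkovMotion P c lam v D Z)
    (hv : IsCoordinate v) {A : Set ℝ} (hA : MeasurableSet A) {t : ℝ} (ht : 0 < t) :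
    P.real {ω | Z t ω ∈ A} = P.real {ω | v (D t ω) = 1 ∧ Z t ω ∈ A} +
      P.real {ω | v (D t ω) = -1 ∧ Z t ω ∈ A} + P.real {ω | v (D t ω) = 0 ∧ Z t ω ∈ A} := by
  have hmA : MeasurableSet {ω | Z t ω ∈ A} := hM.measurable_position t ht hA
  have hm : ∀ i, MeasurableSet {ω | v (D t ω) = i ∧ Z t ω ∈ A} := fun i =>
    (hM.measurableSet_velocity_eq i ht).inter hmA
  have hset : {ω | Z t ω ∈ A} = ({ω | v (D t ω) = 1 ∧ Z t ω ∈ A} ∪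
      {ω | v (D t ω) = -1 ∧ Z t ω ∈ A}) ∪ {ω | v (D t ω) = 0 ∧ Z t ω ∈ A} := by
    ext ω
    have := hv.cases (D t ω)
    simp only [mem_ofPred_eq, mem_union]
    tauto
  rw [hset, measureReal_union _ (hm 0), measureReal_union _ (hm (-1))]
  · rw [disjoint_left]
    rintro ω ⟨h1, -⟩ ⟨h2, -⟩
    rw [h1] at h2
    norm_num at h2
  · rw [disjoint_left]
    rintro ω (⟨h1, -⟩ | ⟨h1, -⟩) ⟨h2, -⟩ <;> rw [h1] at h2 <;> norm_num at h2

open Classical in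
lemma IsReflectingDirection.real_pos_mem_null (hD : IsReflectingDirection P lam T D)
    (hlam : ContinuousOn lam (Ioi 0)) (hpos : ∀ t, 0 < t → 0 ≤ lam t) (hc : 0 < c)
    (hv : IsCoordinate v) {A : Set ℝ} (hA : MeasurableSet A) (hA0 : volume A = 0) {t : ℝ}
    (ht : 0 < t) (hint : IntegrableOn lam (Ioc 0 t)) :
    P.real {ω | pos c v D t ω ∈ A} =
      Real.exp (-∫ q in 0..t, lam q) * (if c * t ∈ A then 1 / 4 else 0) +
      Real.exp (-∫ q in 0..t, lam q) * (if -(c * t) ∈ A then 1 / 4 else 0) +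
      Real.exp (-(2 / 3) * ∫ q in 0..t, lam q) * (if 0 ∈ A then 1 / 2 else 0) := by
  have hM := hD.isMarkovMotion hlam hpos hc.le hv.abs_le_one
  have key := fun (i : ℝ) (hi : i = 1 ∨ i = -1 ∨ i = 0) =>
    hD.real_velocity_mem_null hlam hpos hc hv.abs_le_one (hv.one_le_abs_sub hi) hA hA0 ht hint
  rw [hM.real_mem_eq_add hv hA ht, key 1 (by simp), key (-1) (by simp), key 0 (by simp),
    hv.leaveRate_one, hv.leaveRate_neg_one, hv.leaveRate_zero, hv.mean_one, hv.mean_neg_one,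
    hv.mean_zero]
  simp

/-- Off the atoms the law of a coordinate of the motion is absolutely continuous. -/
lemma IsReflectingDirection.measure_pos_mem_eq_zero (hD : IsReflectingDirection P lam T D)
    (hlam : ContinuousOn lam (Ioi 0)) (hpos : ∀ t, 0 < t → 0 ≤ lam t) (hc : 0 < c)
    (hv : IsCoordinate v) {A : Set ℝ} (hA : MeasurableSet A) (hA0 : volume A = 0) {t : ℝ}
    (ht : 0 < t) (hat : ∀ x ∈ A, (x, t) ∉ atomLines c lam) :
    P {ω | pos c v D t ω ∈ A} = 0 := by
  have hM := hD.isMarkovMotion hlam hpos hc.le hv.abs_le_one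
  suffices h : P.real {ω | pos c v D t ω ∈ A} = 0 from (measureReal_eq_zero_iff).1 h
  by_cases hint : IntegrableOn lam (Ioc 0 t)
  · rw [hD.real_pos_mem_null hlam hpos hc hv hA hA0 ht hint, if_neg, if_neg, if_neg]
    · simp
    · exact fun h => hat _ h ⟨hint, Or.inl rfl⟩
    · exact fun h => hat _ h ⟨hint, Or.inr (Or.inr rfl)⟩
    · exact fun h => hat _ h ⟨hint, Or.inr (Or.inl rfl)⟩
  · have key := fun (i : ℝ) (hi : i = 1 ∨ i = -1 ∨ i = 0) (ha : 0 < leaveRate v i) =>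
      hM.real_velocity_mem_eq_zero hc (hv.one_le_abs_sub hi) ha hA hA0 ht hint
    rw [hM.real_mem_eq_add hv hA ht, key 1 (by simp) (by simp [hv.leaveRate_one]),
      key (-1) (by simp) (by simp [hv.leaveRate_neg_one]),
      key 0 (by simp) (by simp [hv.leaveRate_zero])]
    simp

/-- The singular part lives on a Lebesgue null set, and the law gives no mass to the points of this
set where `ψ` is nonzero, since these avoid the atoms. -/
lemma IsReflectingDirection.integral_mul_acDensity (hD : IsReflectingDirection P lam T D)
    (hlam : ContinuousOn lam (Ioi 0)) (hpos : ∀ t, 0 < t → 0 ≤ lam t) (hc : 0 < c)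
    (hv : IsCoordinate v) {ψ : ℝ → ℝ} (hψ : Continuous ψ) (hcs : HasCompactSupport ψ) {t : ℝ}
    (ht : 0 < t) (hat : ∀ x, ψ x ≠ 0 → (x, t) ∉ atomLines c lam) :
    ∫ x, ψ x * acDensity P (pos c v D) x t = ∫ ω, ψ (pos c v D t ω) ∂P := by
  have hmZ := hD.measurable_pos hlam c v ht
  set μ := P.map (pos c v D t) with hμ
  have : IsProbabilityMeasure μ := Measure.isProbabilityMeasure_map hmZ.aemeasurable
  have hsing : ∫ x, ψ x ∂(μ.singularPart volume) = 0 := by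
    refine integral_eq_zero_of_ae ?_
    obtain ⟨S, hS, hS1, hS2⟩ := Measure.mutuallySingular_singularPart μ volume
    have hmψ : MeasurableSet {x | ψ x ≠ 0} := hψ.measurable (measurableSet_singleton 0).compl
    have h1 : μ.singularPart volume ({x | ψ x ≠ 0} ∩ Sᶜ) = 0 := by
      refine nonpos_iff_eq_zero.1 ((Measure.singularPart_le μ volume _).trans (le_of_eq ?_))
      rw [hμ, Measure.map_apply hmZ (hmψ.inter hS.compl)]
      exact hD.measure_pos_mem_eq_zero hlam hpos hc hv (hmψ.inter hS.compl)
        (measure_mono_null inter_subset_right hS2) ht fun x hx => hat x hx.1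
    change μ.singularPart volume {x | ψ x ≠ 0} = 0
    refine measure_mono_null (fun x hx => ?_) (measure_union_null hS1 h1)
    by_cases hxS : x ∈ S
    · exact Or.inl hxS
    · exact Or.inr ⟨hx, hxS⟩
  rw [← integral_map (φ := pos c v D t) hmZ.aemeasurable hψ.aestronglyMeasurable, ← hμ]
  conv_rhs => rw [← Measure.singularPart_add_rnDeriv μ volume]
  rw [integral_add_measure (integrable_of_test hψ hcs _) (integrable_of_test hψ hcs _), hsing,
    zero_add, integral_withDensity_eq_integral_toReal_smul (Measure.measurable_rnDeriv _ _)
      (Measure.rnDeriv_lt_top _ _)]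
  simp only [acDensity, smul_eq_mul, mul_comm, hμ]

end Law

/-! ### Partial derivatives, and the passage from the weak to the pointwise equation. -/

section PartialDerivatives

/-- The derivative of `g` in the direction `e`. -/
noncomputable def partialDeriv (e : ℝ × ℝ) (g : ℝ × ℝ → ℝ) (z : ℝ × ℝ) : ℝ := fderiv ℝ g z e

variable {U : Set (ℝ × ℝ)} {g : ℝ × ℝ → ℝ}

lemma contDiffOn_partialDeriv (hU : IsOpen U) {n : ℕ} (hg : ContDiffOn ℝ (n + 1 : ℕ) g U)
    (e : ℝ × ℝ) : ContDiffOn ℝ n (partialDeriv e g) U :=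
  (hg.fderiv_of_isOpen hU (by push_cast; exact le_rfl)).clm_apply contDiffOn_const

lemma hasDerivAt_snd (hU : IsOpen U) (hg : ContDiffOn ℝ 1 g U) {x s : ℝ} (h : (x, s) ∈ U) :
    HasDerivAt (fun s => g (x, s)) (partialDeriv (0, 1) g (x, s)) s :=
  ((hg.differentiableOn one_ne_zero).differentiableAt (hU.mem_nhds h)).hasFDerivAt.comp_hasDerivAt s
    ((hasDerivAt_const s x).prodMk (hasDerivAt_id s))

lemma hasDerivAt_fst (hU : IsOpen U) (hg : ContDiffOn ℝ 1 g U) {x s : ℝ} (h : (x, s) ∈ U) :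
    HasDerivAt (fun x => g (x, s)) (partialDeriv (1, 0) g (x, s)) x :=
  ((hg.differentiableOn one_ne_zero).differentiableAt (hU.mem_nhds h)).hasFDerivAt.comp_hasDerivAt x
    ((hasDerivAt_id x).prodMk (hasDerivAt_const x s))

/-- Differentiating again requires the previous identity in a neighbourhood, hence the open set `O`.
-/
lemma iteratedDeriv_of_chain {O : Set ℝ} (hO : IsOpen O) {f₀ f₁ f₂ f₃ : ℝ → ℝ}
    (h0 : ∀ s ∈ O, HasDerivAt f₀ (f₁ s) s) (h1 : ∀ s ∈ O, HasDerivAt f₁ (f₂ s) s)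
    (h2 : ∀ s ∈ O, HasDerivAt f₂ (f₃ s) s) {s : ℝ} (hs : s ∈ O) :
    deriv f₀ s = f₁ s ∧ iteratedDeriv 2 f₀ s = f₂ s ∧ iteratedDeriv 3 f₀ s = f₃ s := by
  have e0 : EqOn (deriv f₀) f₁ O := fun s hs => (h0 s hs).deriv
  have e1 : EqOn (deriv (deriv f₀)) f₂ O := fun s hs => (e0.deriv hO hs).trans (h1 s hs).deriv
  have e2 : EqOn (deriv (deriv (deriv f₀))) f₃ O :=
    fun s hs => (e1.deriv hO hs).trans (h2 s hs).deriv
  simp only [iteratedDeriv_succ, iteratedDeriv_zero]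
  exact ⟨e0 hs, e1 hs, e2 hs⟩

lemma continuousOn_mul_slice (hg : ContinuousOn g U) {φ : ℝ → ℝ} (hφ : Continuous φ) {a b s : ℝ}
    (hbox : ∀ x ∈ uIcc a b, (x, s) ∈ U) : ContinuousOn (fun x => φ x * g (x, s)) (uIcc a b) :=
  hφ.continuousOn.mul (hg.comp (by fun_prop) hbox)

/-- On the compact box the differentiated integrand is bounded, and a constant dominates it. -/
lemma hasDerivAt_integral_slice (hU : IsOpen U) (hg : ContDiffOn ℝ 1 g U) {φ : ℝ → ℝ}
    (hφ : Continuous φ) {a b α β : ℝ} (hbox : ∀ x ∈ uIcc a b, ∀ s ∈ Icc α β, (x, s) ∈ U) {s : ℝ}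
    (hs : s ∈ Ioo α β) :
    HasDerivAt (fun s => ∫ x in a..b, φ x * g (x, s))
      (∫ x in a..b, φ x * partialDeriv (0, 1) g (x, s)) s := by
  have hd : ContinuousOn (partialDeriv (0, 1) g) U :=
    (contDiffOn_partialDeriv hU (n := 0) hg (0, 1)).continuousOn
  have hc : ContinuousOn (fun z : ℝ × ℝ => φ z.1 * partialDeriv (0, 1) g z) (uIcc a b ×ˢ Icc α β) :=
    (hφ.comp continuous_fst).continuousOn.mul (hd.mono fun z hz => hbox z.1 hz.1 z.2 hz.2)
  obtain ⟨M, hM⟩ := (isCompact_uIcc.prod isCompact_Icc).exists_bound_of_continuousOn hc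
  have hmem : Ioo α β ∈ 𝓝 s := Ioo_mem_nhds hs.1 hs.2
  have hcont : ∀ {h : ℝ × ℝ → ℝ}, ContinuousOn h U → ∀ s ∈ Ioo α β,
      ContinuousOn (fun x => φ x * h (x, s)) (uIcc a b) := fun hh s hs =>
    continuousOn_mul_slice hh hφ fun x hx => hbox x hx s (Ioo_subset_Icc_self hs)
  refine (intervalIntegral.hasDerivAt_integral_of_dominated_loc_of_deriv_le (bound := fun _ => M)
    (F' := fun s x => φ x * partialDeriv (0, 1) g (x, s)) hmem ?_ ?_ ?_ ?_ ?_ ?_).2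
  · filter_upwards [hmem] with s hs
    exact ((hcont hg.continuousOn s hs).mono uIoc_subset_uIcc).aestronglyMeasurable measurableSet_uIoc
  · exact (hcont hg.continuousOn s hs).intervalIntegrable
  · exact ((hcont hd s hs).mono uIoc_subset_uIcc).aestronglyMeasurable measurableSet_uIoc
  · exact ae_of_all _ fun x hx s hs => hM (x, s) ⟨uIoc_subset_uIcc hx, Ioo_subset_Icc_self hs⟩
  · simp
  · exact ae_of_all _ fun x hx s hs => (hasDerivAt_snd hU hg
      (hbox x (uIoc_subset_uIcc hx) s (Ioo_subset_Icc_self hs))).const_mul _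

lemma integral_deriv_mul_slice (hU : IsOpen U) (hg : ContDiffOn ℝ 1 g U) {φ : ℝ → ℝ}
    (hφ : ContDiff ℝ 1 φ) {a b s : ℝ} (hbox : ∀ x ∈ uIcc a b, (x, s) ∈ U) (ha : φ a = 0)
    (hb : φ b = 0) :
    ∫ x in a..b, deriv φ x * g (x, s) = -∫ x in a..b, φ x * partialDeriv (1, 0) g (x, s) := by
  have hd : ContinuousOn (partialDeriv (1, 0) g) U :=
    (contDiffOn_partialDeriv hU (n := 0) hg (1, 0)).continuousOn
  have h := intervalIntegral.integral_mul_deriv_eq_deriv_mul (a := a) (b := b)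
    (fun x hx => hasDerivAt_fst hU hg (hbox x hx))
    (fun x _ => (hφ.differentiable one_ne_zero x).hasDerivAt)
    ((hd.comp (by fun_prop) hbox).intervalIntegrable)
    ((hφ.continuous_deriv le_rfl).intervalIntegrable _ _)
  simp only [ha, hb, mul_zero, sub_zero, zero_sub] at h
  simpa only [mul_comm] using h

end PartialDerivatives

/-- The weak form of the equation implies the pointwise form. -/
lemma SolvesWeaklyOff.solvesPointwiseOff {c : ℝ} {lam : ℝ → ℝ} {A : Set (ℝ × ℝ)} {p : ℝ → ℝ → ℝ}
    (h : SolvesWeaklyOff c lam A p) : SolvesPointwiseOff c lam A p := by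
  intro U q hU hUA hq hqp x₀ t₀ hz
  set Q : ℝ × ℝ → ℝ := fun z => q z.1 z.2 with hQ
  set dT := partialDeriv (0, 1) with hdT
  set dX := partialDeriv (1, 0) with hdX
  have c1 : ContDiffOn ℝ 2 (dT Q) U := contDiffOn_partialDeriv hU (n := 2) hq _
  have c2 : ContDiffOn ℝ 1 (dT (dT Q)) U := contDiffOn_partialDeriv hU (n := 1) c1 _
  have c3 : ContDiffOn ℝ 0 (dT (dT (dT Q))) U := contDiffOn_partialDeriv hU (n := 0) c2 _
  have b1 : ContDiffOn ℝ 2 (dX Q) U := contDiffOn_partialDeriv hU (n := 2) hq _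
  have b2 : ContDiffOn ℝ 1 (dX (dX Q)) U := contDiffOn_partialDeriv hU (n := 1) b1 _
  have b3 : ContDiffOn ℝ 0 (dT (dX (dX Q))) U := contDiffOn_partialDeriv hU (n := 0) b2 _
  have hq1 : ContDiffOn ℝ 1 Q U := hq.of_le (by norm_num)
  have c11 : ContDiffOn ℝ 1 (dT Q) U := c1.of_le (by norm_num)
  have b11 : ContDiffOn ℝ 1 (dX Q) U := b1.of_le (by norm_num)
  obtain ⟨ε, hε, hball⟩ : ∃ ε > 0, ∀ x ∈ Icc (x₀ - ε) (x₀ + ε), ∀ s ∈ Icc (t₀ - ε) (t₀ + ε),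
      (x, s) ∈ U := by
    obtain ⟨ε, hε, hb⟩ := Metric.nhds_basis_closedBall.mem_iff.1 (hU.mem_nhds hz)
    refine ⟨ε, hε, fun x hx s hs => hb ?_⟩
    rw [← closedBall_prod_same, Real.closedBall_eq_Icc, Real.closedBall_eq_Icc]
    exact ⟨hx, hs⟩
  set a := x₀ - ε
  set b := x₀ + ε
  have hab : a < b := by simp only [a, b]; linarith
  have hbox : ∀ x ∈ uIcc a b, ∀ s ∈ Icc (t₀ - ε) (t₀ + ε), (x, s) ∈ U := by
    rw [uIcc_of_le hab.le]; exact hball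
  set O := Ioo (t₀ - ε) (t₀ + ε)
  have ht₀ : t₀ ∈ O := ⟨by linarith, by linarith⟩
  have hO : O ∈ 𝓝 t₀ := isOpen_Ioo.mem_nhds ht₀
  have hx₀ : x₀ ∈ Ioo a b := ⟨by simp only [a]; linarith, by simp only [b]; linarith⟩
  -- the slices of the version
  have slice := iteratedDeriv_of_chain (O := {s | (x₀, s) ∈ U}) (hU.preimage (by fun_prop))
    (fun s hs => hasDerivAt_snd hU hq1 hs) (fun s hs => hasDerivAt_snd hU c11 hs)
    (fun s hs => hasDerivAt_snd hU c2 hs) hz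
  have sliceX : ∀ s ∈ O, iteratedDeriv 2 (fun y => q y s) x₀ = dX (dX Q) (x₀, s) := by
    intro s hs
    have hO' : IsOpen {x | (x, s) ∈ U} := hU.preimage (by fun_prop)
    have e0 : EqOn (deriv fun y => q y s) (fun x => dX Q (x, s)) {x | (x, s) ∈ U} :=
      fun x hx => (hasDerivAt_fst hU hq1 hx).deriv
    have hmem : (x₀, s) ∈ U := hball _ (Ioo_subset_Icc_self hx₀) s (Ioo_subset_Icc_self hs)
    rw [iteratedDeriv_succ, iteratedDeriv_one]
    exact (e0.deriv hO' hmem).trans (hasDerivAt_fst hU b11 hmem).deriv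
  have sliceXT : deriv (fun s => iteratedDeriv 2 (fun y => q y s) x₀) t₀ =
      dT (dX (dX Q)) (x₀, t₀) := by
    have : (fun s => iteratedDeriv 2 (fun y => q y s) x₀) =ᶠ[𝓝 t₀] fun s => dX (dX Q) (x₀, s) := by
      filter_upwards [hO] with s hs using sliceX s hs
    rw [this.deriv_eq]
    exact (hasDerivAt_snd hU b2 hz).deriv
  -- `R` is the defect of the equation at time `t₀`. It is continuous on the box, so it suffices to
  -- show that its integrals against test functions vanish.
  set R : ℝ → ℝ := fun x => dT (dT (dT Q)) (x, t₀) + (8 * lam t₀ / 3) * dT (dT Q) (x, t₀)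
      + (4 / 3) * ((4 / 3) * lam t₀ ^ 2 + deriv lam t₀) * dT Q (x, t₀)
      - (c ^ 2 * dT (dX (dX Q)) (x, t₀) + (2 * c ^ 2 * lam t₀ / 3) * dX (dX Q) (x, t₀)) with hR
  have hslice : ∀ {g : ℝ × ℝ → ℝ}, ContinuousOn g U →
      ContinuousOn (fun x => g (x, t₀)) (Icc a b) := fun hg =>
    hg.comp (by fun_prop) fun x hx => hball x hx t₀ (Ioo_subset_Icc_self ht₀)
  have hRc : ContinuousOn R (Icc a b) := by
    have h1 := hslice c3.continuousOn
    have h2 := hslice c2.continuousOn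
    have h3 := hslice c1.continuousOn
    have h4 := hslice b3.continuousOn
    have h5 := hslice b2.continuousOn
    exact ((h1.add (h2.const_mul _)).add (h3.const_mul _)).sub
      ((h4.const_mul _).add (h5.const_mul _))
  have hae : ∀ᵐ x ∂(volume : Measure ℝ), x ∈ Ioo a b → R x = 0 := by
    refine isOpen_Ioo.ae_eq_zero_of_integral_contDiff_smul_eq_zero
      ((hRc.mono Ioo_subset_Icc_self).locallyIntegrableOn measurableSet_Ioo) fun ψ hψ hcs hsupp => ?_
    have hψ0 : ∀ x, x ∉ Ioo a b → ψ x = 0 := fun x hx =>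
      image_eq_zero_of_notMem_tsupport fun h => hx (hsupp h)
    have hψ1 : ContDiff ℝ ((⊤ : ℕ∞) : WithTop ℕ∞) (deriv ψ) := (contDiff_infty_iff_deriv.1 hψ).2
    have hψ2 : iteratedDeriv 2 ψ = deriv (deriv ψ) := by
      rw [iteratedDeriv_succ, iteratedDeriv_one]
    have hψ1' : ∀ x, x ∉ Ioo a b → deriv ψ x = 0 := fun x hx =>
      image_eq_zero_of_notMem_tsupport fun h => hx (hsupp (tsupport_deriv_subset h))
    have hψ2' : ∀ x, x ∉ Ioo a b → iteratedDeriv 2 ψ x = 0 := fun x hx => by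
      rw [hψ2]
      exact image_eq_zero_of_notMem_tsupport fun h =>
        hx (hsupp (tsupport_deriv_subset (tsupport_deriv_subset h)))
    have hint : ∀ φ : ℝ → ℝ, (∀ x, x ∉ Ioo a b → φ x = 0) → ∀ f : ℝ → ℝ,
        ∫ x, φ x * f x = ∫ x in a..b, φ x * f x := fun φ hφ f => by
      refine (intervalIntegral.integral_eq_integral_of_support_subset fun x hx => ?_).symm
      by_contra hx'
      exact hx (by simp [hφ x fun h => hx' (Ioo_subset_Ioc_self h)])
    have hrep : ∀ φ : ℝ → ℝ, (∀ x, x ∉ Ioo a b → φ x = 0) → ∀ s ∈ O,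
        ∫ x, φ x * p x s = ∫ x in a..b, φ x * Q (x, s) := by
      intro φ hφ s hs
      rw [← hint φ hφ]
      have hs0 : 0 < s := (hUA _ (hball x₀ (Ioo_subset_Icc_self hx₀) s (Ioo_subset_Icc_self hs))).1
      refine integral_congr_ae ?_
      filter_upwards [hqp s hs0] with x hx
      by_cases hxa : x ∈ Ioo a b
      · rw [← hx (hball x (Ioo_subset_Icc_self hxa) s (Ioo_subset_Icc_self hs))]
      · rw [hφ x hxa, zero_mul, zero_mul]
    have ht0 := (hUA _ hz).1
    obtain ⟨-, -, heq⟩ := h t₀ ht0 ψ hψ hcs fun x hx => (hUA _ (hball x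
      (Ioo_subset_Icc_self (hsupp hx)) t₀ (Ioo_subset_Icc_self ht₀))).2
    have hF : (fun s => ∫ x, ψ x * p x s) =ᶠ[𝓝 t₀] fun s => ∫ x in a..b, ψ x * Q (x, s) := by
      filter_upwards [hO] with s hs using hrep ψ hψ0 s hs
    have hGs : ∀ s ∈ O, ∫ x, iteratedDeriv 2 ψ x * p x s =
        ∫ x in a..b, ψ x * dX (dX Q) (x, s) := by
      intro s hs
      have hb : ∀ x ∈ uIcc a b, (x, s) ∈ U := fun x hx => hbox x hx s (Ioo_subset_Icc_self hs)
      -- Two integrations by parts move the derivatives from `ψ` to `Q`; the boundary terms vanish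
      -- because `ψ` is supported inside `(a, b)`.
      rw [hrep _ hψ2' s hs, hψ2, integral_deriv_mul_slice hU hq1 (contDiff_infty.1 hψ1 1) hb
        (hψ1' a (by simp)) (hψ1' b (by simp)), integral_deriv_mul_slice hU b11
        (contDiff_infty.1 hψ 1) hb (hψ0 a (by simp)) (hψ0 b (by simp)), neg_neg]
    have hG : (fun s => ∫ x, iteratedDeriv 2 ψ x * p x s) =ᶠ[𝓝 t₀]
        fun s => ∫ x in a..b, ψ x * dX (dX Q) (x, s) := by
      filter_upwards [hO] with s hs using hGs s hs
    have chain := iteratedDeriv_of_chain isOpen_Ioo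
      (fun s hs => hasDerivAt_integral_slice hU hq1 hψ.continuous hbox hs)
      (fun s hs => hasDerivAt_integral_slice hU c11 hψ.continuous hbox hs)
      (fun s hs => hasDerivAt_integral_slice hU c2 hψ.continuous hbox hs) ht₀
    have chainG := (hasDerivAt_integral_slice hU b2 hψ.continuous hbox ht₀).deriv
    rw [EquationAt, hF.iteratedDeriv_eq, hF.iteratedDeriv_eq, hF.deriv_eq, hG.deriv_eq,
      hGs t₀ ht₀, chain.1, chain.2.1, chain.2.2, chainG] at heq
    have hi : ∀ {g : ℝ × ℝ → ℝ}, ContinuousOn g U →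
        IntervalIntegrable (fun x => ψ x * g (x, t₀)) volume a b := fun hg =>
      (continuousOn_mul_slice hg hψ.continuous fun x hx =>
        hbox x hx t₀ (Ioo_subset_Icc_self ht₀)).intervalIntegrable
    have i1 := hi c3.continuousOn
    have i2 := (hi c2.continuousOn).const_mul (8 * lam t₀ / 3)
    have i3 := (hi c1.continuousOn).const_mul (4 / 3 * (4 / 3 * lam t₀ ^ 2 + deriv lam t₀))
    have i4 := (hi b3.continuousOn).const_mul (c ^ 2)
    have i5 := (hi b2.continuousOn).const_mul (2 * c ^ 2 * lam t₀ / 3)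
    have hsplit : ∫ x in a..b, ψ x * R x =
        (∫ x in a..b, ψ x * dT (dT (dT Q)) (x, t₀)) +
        (8 * lam t₀ / 3) * (∫ x in a..b, ψ x * dT (dT Q) (x, t₀)) +
        (4 / 3 * (4 / 3 * lam t₀ ^ 2 + deriv lam t₀)) * (∫ x in a..b, ψ x * dT Q (x, t₀)) -
        (c ^ 2 * (∫ x in a..b, ψ x * dT (dX (dX Q)) (x, t₀)) +
          (2 * c ^ 2 * lam t₀ / 3) * (∫ x in a..b, ψ x * dX (dX Q) (x, t₀))) := by
      simp only [← intervalIntegral.integral_const_mul]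
      rw [← intervalIntegral.integral_add i1 i2, ← intervalIntegral.integral_add (i1.add i2) i3,
        ← intervalIntegral.integral_add i4 i5,
        ← intervalIntegral.integral_sub ((i1.add i2).add i3) (i4.add i5)]
      refine intervalIntegral.integral_congr fun x _ => ?_
      simp only [hR]
      ring
    simp only [smul_eq_mul]
    rw [hint ψ hψ0 R, hsplit]
    linear_combination heq
  have hR0 : R x₀ = 0 := by
    have h1 : R =ᵐ[volume.restrict (Ioo a b)] fun _ => 0 := by
      rw [EventuallyEq, ae_restrict_iff' measurableSet_Ioo]
      exact hae
    exact Measure.eqOn_open_of_ae_eq h1 isOpen_Ioo (hRc.mono Ioo_subset_Icc_self)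
      continuousOn_const hx₀
  rw [EquationAt, sliceXT, sliceX t₀ ht₀]
  rw [show deriv (fun s => q x₀ s) t₀ = dT Q (x₀, t₀) from slice.1,
    show iteratedDeriv 2 (fun s => q x₀ s) t₀ = dT (dT Q) (x₀, t₀) from slice.2.1,
    show iteratedDeriv 3 (fun s => q x₀ s) t₀ = dT (dT (dT Q)) (x₀, t₀) from slice.2.2]
  simp only [hR] at hR0
  linarith

/-! ### Assembly of the weak equation and the atoms. -/

section Main

variable {Ω : Type*} [MeasurableSpace Ω] {P : Measure Ω} [IsProbabilityMeasure P] {lam : ℝ → ℝ}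
  {T : Ω → Set ℝ} {D : ℝ → Ω → Fin 4} {c : ℝ} {v : Fin 4 → ℝ}

/-- Derivatives in time involve nearby times, at which the test function must still avoid the atoms.
These move continuously while `K` is closed; and if the rate is not integrable up to `t`, it is not
integrable up to any positive time. -/
lemma eventually_notMem_atomLines (hlam : ContinuousOn lam (Ioi 0)) {K : Set ℝ} (hK : IsClosed K)
    {t : ℝ} (ht : 0 < t) (h : ∀ x ∈ K, (x, t) ∉ atomLines c lam) :
    ∀ᶠ s in 𝓝 t, 0 < s ∧ ∀ x ∈ K, (x, s) ∉ atomLines c lam := by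
  by_cases hint : IntegrableOn lam (Ioc 0 t)
  · have h0 : (0 : ℝ) ∉ K := fun hx => h _ hx ⟨hint, Or.inl rfl⟩
    have h1 : c * t ∈ Kᶜ := fun hx => h _ hx ⟨hint, Or.inr (Or.inl rfl)⟩
    have h2 : -(c * t) ∈ Kᶜ := fun hx => h _ hx ⟨hint, Or.inr (Or.inr rfl)⟩
    have e1 : ∀ᶠ s in 𝓝 t, c * s ∈ Kᶜ :=
      (by fun_prop : ContinuousAt (fun s => c * s) t).eventually (hK.isOpen_compl.mem_nhds h1)
    have e2 : ∀ᶠ s in 𝓝 t, -(c * s) ∈ Kᶜ :=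
      (by fun_prop : ContinuousAt (fun s => -(c * s)) t).eventually (hK.isOpen_compl.mem_nhds h2)
    filter_upwards [e1, e2, Ioi_mem_nhds ht] with s h1 h2 hs
    refine ⟨hs, fun x hx hat => ?_⟩
    rcases hat.2 with h | h | h
    · exact h0 (h ▸ hx)
    · exact h1 (h ▸ hx)
    · exact h2 (h ▸ hx)
  · filter_upwards [Ioi_mem_nhds ht] with s hs
    exact ⟨hs, fun x _ hat => hint (integrableOn_rate_zero hlam hs hat.1 t)⟩

lemma IsReflectingDirection.solvesWeaklyOff (hD : IsReflectingDirection P lam T D)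
    (hlam : ContDiffOn ℝ 1 lam (Ioi 0)) (hpos : ∀ t, 0 < t → 0 ≤ lam t) (hc : 0 < c)
    (hv : IsCoordinate v) :
    SolvesWeaklyOff c lam (atomLines c lam) (acDensity P (pos c v D)) := by
  intro t ht ψ hψ hcs hsupp
  have hlc := hlam.continuousOn
  have hM := hD.isMarkovMotion hlc hpos hc.le hv.abs_le_one
  have hev := eventually_notMem_atomLines hlc (isClosed_tsupport ψ) ht hsupp
  have hψ1 : ContDiff ℝ ((⊤ : ℕ∞) : WithTop ℕ∞) (deriv ψ) := (contDiff_infty_iff_deriv.1 hψ).2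
  have hψ2 : iteratedDeriv 2 ψ = deriv (deriv ψ) := by
    rw [iteratedDeriv_succ, iteratedDeriv_one]
  have hψ2c : Continuous (iteratedDeriv 2 ψ) := by
    rw [hψ2]; exact hψ1.continuous_deriv (by simp)
  have hψ2s : HasCompactSupport (iteratedDeriv 2 ψ) := by
    rw [hψ2]; exact hcs.deriv.deriv
  have hψ2t : tsupport (iteratedDeriv 2 ψ) ⊆ tsupport ψ := by
    rw [hψ2]; exact (tsupport_deriv_subset).trans tsupport_deriv_subset
  have hF : (fun s => ∫ x, ψ x * acDensity P (pos c v D) x s) =ᶠ[𝓝 t]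
      fun s => ∫ ω, ψ (pos c v D s ω) ∂P := by
    filter_upwards [hev] with s hs
    exact hD.integral_mul_acDensity hlc hpos hc hv hψ.continuous hcs hs.1
      fun x hx => hs.2 x (subset_tsupport _ hx)
  have hG : (fun s => ∫ x, iteratedDeriv 2 ψ x * acDensity P (pos c v D) x s) =ᶠ[𝓝 t]
      fun s => ∫ ω, iteratedDeriv 2 ψ (pos c v D s ω) ∂P := by
    filter_upwards [hev] with s hs
    exact hD.integral_mul_acDensity hlc hpos hc hv hψ2c hψ2s hs.1
      fun x hx => hs.2 x (hψ2t (subset_tsupport _ hx))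
  obtain ⟨h1, h2, h3⟩ := hM.weak_equation hlam hv.sum_eq hv.sum_sq hv.cube hψ hcs ht
  refine ⟨h1.congr_of_eventuallyEq hF, h2.congr_of_eventuallyEq hG, ?_⟩
  rw [EquationAt, hF.iteratedDeriv_eq, hF.iteratedDeriv_eq, hF.deriv_eq, hG.deriv_eq, hG.eq_of_nhds]
  exact h3

lemma IsReflectingDirection.measure_atoms (hD : IsReflectingDirection P lam T D)
    (hlam : ContinuousOn lam (Ioi 0)) (hpos : ∀ t, 0 < t → 0 ≤ lam t) (hc : 0 < c)
    (hv : IsCoordinate v) {t : ℝ} (ht : 0 < t) (hint : IntegrableOn lam (Ioc 0 t)) :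
    P {ω | pos c v D t ω = c * t} = ENNReal.ofReal (Real.exp (-∫ s in 0..t, lam s) / 4) ∧
    P {ω | pos c v D t ω = -(c * t)} = ENNReal.ofReal (Real.exp (-∫ s in 0..t, lam s) / 4) ∧
    P {ω | pos c v D t ω = 0} = ENNReal.ofReal (Real.exp (-(2 / 3) * ∫ s in 0..t, lam s) / 2) := by
  have key := fun x : ℝ => hD.real_pos_mem_null hlam hpos hc hv (measurableSet_singleton x)
    (Real.volume_singleton) ht hint
  -- Positivity of `c * t` keeps the three atoms distinct, so each singleton retains exactly one
  -- term of the formula for null sets.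
  have hct : 0 < c * t := mul_pos hc ht
  have e1 : -(c * t) ≠ c * t := by linarith
  have e2 : (0 : ℝ) ≠ c * t := hct.ne
  have e3 : (0 : ℝ) ≠ -(c * t) := by linarith
  have k1 := key (c * t)
  have k2 := key (-(c * t))
  have k3 := key 0
  simp only [mem_singleton_iff, e1, e2, e3, e1.symm, e2.symm, e3.symm, if_true, if_false, mul_zero,
    add_zero, zero_add] at k1 k2 k3
  refine ⟨?_, ?_, ?_⟩
  · rw [← ofReal_measureReal, k1, mul_one_div]
  · rw [← ofReal_measureReal, k2, mul_one_div]
  · rw [← ofReal_measureReal, k3, mul_one_div]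

end Main

end ReflectingMotion

theorem mainTheorem10 {Ω : Type*} [MeasurableSpace Ω] (P : MeasureTheory.Measure Ω)
    [MeasureTheory.IsProbabilityMeasure P] (c : ℝ) (hc : 0 < c) (lam : ℝ → ℝ)
    (hlam : ContDiffOn ℝ 1 lam (Set.Ioi 0)) (hlam_nonneg : ∀ t, 0 < t → 0 ≤ lam t)
    (T : Ω → Set ℝ) (D : ℝ → Ω → Fin 4)
    (hD : ReflectingMotion.IsReflectingDirection P lam T D)
    (Z : ℝ → Ω → ℝ) (hZ : Z = ReflectingMotion.posX c D ∨ Z = ReflectingMotion.posY c D) :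
    ReflectingMotion.SolvesWeaklyOff c lam (ReflectingMotion.atomLines c lam)
      (ReflectingMotion.acDensity P Z) ∧
    ReflectingMotion.SolvesPointwiseOff c lam (ReflectingMotion.atomLines c lam)
      (ReflectingMotion.acDensity P Z) ∧
    ∀ t, 0 < t → MeasureTheory.IntegrableOn lam (Set.Ioc 0 t) MeasureTheory.volume →
      P {ω | Z t ω = c * t} = ENNReal.ofReal (Real.exp (-∫ s in 0..t, lam s) / 4) ∧
      P {ω | Z t ω = -(c * t)} = ENNReal.ofReal (Real.exp (-∫ s in 0..t, lam s) / 4) ∧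
      P {ω | Z t ω = 0} = ENNReal.ofReal (Real.exp (-(2 / 3) * ∫ s in 0..t, lam s) / 2) := by
  obtain ⟨v, hv, rfl⟩ : ∃ v, ReflectingMotion.IsCoordinate v ∧ Z = ReflectingMotion.pos c v D := by
    rcases hZ with h | h
    · exact ⟨_, ReflectingMotion.isCoordinate_dirX, h⟩
    · exact ⟨_, ReflectingMotion.isCoordinate_dirY, h⟩
  have hweak := hD.solvesWeaklyOff hlam hlam_nonneg hc hv
  exact ⟨hweak, hweak.solvesPointwiseOff, fun t ht hint =>
    hD.measure_atoms hlam.continuousOn hlam_nonneg hc hv ht hint⟩
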